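/- **Setting.** Let $n,m\ge 1$, let $f_i:\mathbb{R}^l\to\mathbb{R}$ ($1\le i\le n$) and $g_j:\mathbb{R}^d\to\mathbb{R}^l$ ($1\le j\le m$) be differentiable, and put $f=\frac1n\sum_i f_i$, $g=\frac1m\sum_j g_j$, $\Phi=f\circ g$. Write $\partial g_j$ for the Jacobian, $\|\cdot\|$ for the Euclidean norm and the operator norm, and $\|\cdot\|_F$ for the Frobenius norm. Let $x_0\in\mathbb{R}^d$. Assume that $\Phi$ is bounded below and that $\Delta:=\Phi(x_0)-\inf\Phi>0$. Assume that there are constants $L_f,L_g\ge 0$ and $M_f,M_g,H_1,H_2,H_3>0$ such that for all $i,j$ and all $x,x'\in\mathbb{R}^d$, $y,y'\in\mathbb{R}^l$: - $\|\partial g_j(x)-\partial g_j(x')\|_F\le L_g\|x-x'\|$ and $\|\nabla f_i(y)-\nabla f_i(y')\|\le L_f\|y-y'\|$; - $\|\partial g_j(x)\|\le M_g$ and $\|\nabla f_i(y)\|\le M_f$; - $\frac1n\sum_i\|\nabla f_i(y)-\nabla f(y)\|^2\le H_1$, $\ \frac1m\sum_j\|\partial g_j(x)-\partial g(x)\|_F^2\le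 H_2$, $\ \frac1m\sum_j\|g_j(x)-g(x)\|^2\le H_3$. Put $L_\Phi=M_fL_g+M_g^2L_f$ and assume $L_\Phi>0$. **Algorithm (STORM-Compositional).** The inputs are $x_0$, a learning rate $\eta>0$, a precision $\varepsilon>0$, weights $a_g,a_{\partial g},a_\Phi\in(0,1)$, and positive integers $B_g,B_{\partial g},B_f$, $S_g,S_{\partial g},S_f$ and $T$. A minibatch of size $B$ consists of $B$ independent uniform indices (drawn with replacement), all minibatches are independent, and $q(x,\mathcal{B})=\frac1B\sum_{i\in\mathcal{B}}q_i(x)$. Draw minibatches of sizes $S_g,S_{\partial g},S_f$ and set $\boldsymbol g_0=g(x_0,\mathcal S_0^g)$, $\boldsymbol G_0=\partial g(x_0,\mathcal S_0^{\partial g})$, $\boldsymbol F_0=\boldsymbol G_0^T\nabla f(\boldsymbol g_0,\mathcal S_0^f)$. For $t=0,\dots,T-1$, let $\widetilde x_{t+1}=x_t-\eta\boldsymbol F_t$ and $$x_{t+1}=x_t+\gamma_t(\widetilde x_{t+1}-x_t),\qquad \gamma_t=\min\Big\{\frac{\eta\varepsilon}{\|\widetilde x_{t+1}-x_t\|},\frac12\Big\}$$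 (with $x_{t+1}=x_t$ if $\boldsymbol F_t=0$), draw minibatches of sizes $B_g,B_{\partial g},B_f$, and set $$\boldsymbol g_{t+1}=(1-a_g)\boldsymbol g_t+a_g\,g(x_{t+1},\mathcal B^g_{t+1})+(1-a_g)\big[g(x_{t+1},\mathcal B^g_{t+1})-g(x_t,\mathcal B^g_{t+1})\big],$$ $$\boldsymbol G_{t+1}=(1-a_{\partial g})\boldsymbol G_t+a_{\partial g}\,\partial g(x_{t+1},\mathcal B^{\partial g}_{t+1})+(1-a_{\partial g})\big[\partial g(x_{t+1},\mathcal B^{\partial g}_{t+1})-\partial g(x_t,\mathcal B^{\partial g}_{t+1})\big],$$ $$\boldsymbol F_{t+1}=(1-a_\Phi)\boldsymbol F_t+a_\Phi\boldsymbol G_{t+1}^T\nabla f(\boldsymbol g_{t+1},\mathcal B^f_{t+1})+(1-a_\Phi)\big[\boldsymbol G_{t+1}^T\nabla f(\boldsymbol g_{t+1},\mathcal B^f_{t+1})-\boldsymbol G_t^T\nabla f(\boldsymbol g_t,\mathcal B^f_{t+1})\big].$$ The output $\widehat x$ is chosen uniformly at random from $x_1,\dots,x_T$, independently of everything else. The IFO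 (incremental first-order oracle) cost of a run is the total number of component indices drawn into its minibatches; each drawn index is charged once, also when its component is evaluated at two successive points. **Theorem 1.** Let $\varepsilon>0$, let $\alpha_g,\alpha_{\partial g},\alpha_\Phi,\beta_g,\beta_{\partial g},\beta_f,\gamma_g,\gamma_{\partial g},\gamma_f>0$, and run the algorithm with $a_g=\alpha_g\varepsilon$, $a_{\partial g}=\alpha_{\partial g}\varepsilon$, $a_\Phi=\alpha_\Phi\varepsilon$ (all $<1$), $B_g=\beta_g\varepsilon^{-1}$, $B_{\partial g}=\beta_{\partial g}\varepsilon^{-1}$, $B_f=\beta_f\varepsilon^{-1}$, $S_g=\gamma_g\varepsilon^{-1}$, $S_{\partial g}=\gamma_{\partial g}\varepsilon^{-1}$, $S_f=\gamma_f\varepsilon^{-1}$, $T=\frac{32}{3}L_\Phi\Delta\varepsilon^{-2}$ and $\eta=1/L_\Phi$, where the batch sizes and $T$ are integers. Put $K=2M_g+\dfrac{L_g}{L_\Phi\alpha_{\partial g}}$. If $$\begin{aligned} &\Big\{\tfrac{36M_f^2L_g^2}{\alpha_\Phi\beta_f}\Big[\tfrac{4}{\alpha_{\partial g}\beta_{\partial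 g}}+\tfrac{2\varepsilon}{\beta_{\partial g}}+1\Big]+\tfrac{36L_f^2M_g^2}{\alpha_\Phi\beta_f}K^2\Big[\tfrac{4}{\alpha_g\beta_g}+\tfrac{2\varepsilon}{\beta_g}+1\Big]+\tfrac{6M_f^2L_g^2}{\alpha_{\partial g}\beta_{\partial g}}+\tfrac{6M_g^4L_f^2}{\alpha_g\beta_g}\Big\}\tfrac{1}{L_\Phi^2}\\ &+\tfrac{6M_f^2H_2}{\frac{32}{3}L_\Phi\Delta\alpha_{\partial g}\gamma_{\partial g}}\Big(\tfrac{24}{\alpha_\Phi\beta_f}+1\Big)+\tfrac{6L_f^2H_3}{\frac{32}{3}L_\Phi\Delta\alpha_g\gamma_g}\Big(\tfrac{24}{\alpha_\Phi\beta_f}K^2+M_g^2\Big)+\tfrac{3M_g^2H_1}{\frac{32}{3}L_\Phi\Delta\alpha_\Phi\gamma_f}\\ &+\tfrac{72M_f^2\alpha_{\partial g}H_2}{\alpha_\Phi\beta_f\beta_{\partial g}}(2+\alpha_{\partial g}\varepsilon)+\tfrac{72L_f^2\alpha_gH_3}{\alpha_\Phi\beta_f\beta_g}K^2(2+\alpha_g\varepsilon)+\tfrac{6\alpha_\Phi}{\beta_f}K^2H_1+\tfrac{6M_f^2\alpha_{\partial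 g}H_2}{\beta_{\partial g}}+\tfrac{6M_g^2L_f^2\alpha_gH_3}{\beta_g}\ \le\ \tfrac1{16}, \end{aligned}$$ then $\mathbf{E}\|\nabla\Phi(\widehat x)\|\le\varepsilon$, and the total IFO cost is $$(\gamma_g+\gamma_{\partial g}+\gamma_f)\varepsilon^{-1}+\tfrac{32}{3}L_\Phi\Delta(\beta_g+\beta_{\partial g}+\beta_f)\varepsilon^{-3}.$$ -/

import Mathlib

open scoped BigOperators

noncomputable section

/-- Arithmetic mean of a finite family, i.e. its expectation under a uniformly random index. -/
def mean {ι E : Type*} [Fintype ι] [AddCommGroup E] [Module ℝ E] (q : ι → E) : E :=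
  (Fintype.card ι : ℝ)⁻¹ • ∑ i, q i

/-- Frobenius norm of a linear map between Euclidean spaces (of its matrix in standard bases). -/
def frobNorm {d l : ℕ} (A : EuclideanSpace ℝ (Fin d) →L[ℝ] EuclideanSpace ℝ (Fin l)) : ℝ :=
  Real.sqrt (∑ k : Fin d, ‖A (EuclideanSpace.single k 1)‖ ^ 2)

/-- Data of a finite-sum compositional problem: outer functions `f i`, inner functions `g j`. -/
structure CompProblem (n m d l : ℕ) where
  f : Fin n → EuclideanSpace ℝ (Fin l) → ℝ
  g : Fin m → EuclideanSpace ℝ (Fin d) → EuclideanSpace ℝ (Fin l)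

namespace CompProblem

variable {n m d l : ℕ}

/-- The outer function `f = (1/n) ∑ f i`. -/
def outer (P : CompProblem n m d l) (y : EuclideanSpace ℝ (Fin l)) : ℝ :=
  mean fun i => P.f i y

/-- The inner function `g = (1/m) ∑ g j`. -/
def inner (P : CompProblem n m d l) (x : EuclideanSpace ℝ (Fin d)) : EuclideanSpace ℝ (Fin l) :=
  mean fun j => P.g j x

/-- The objective `Φ = f ∘ g`. -/
def Phi (P : CompProblem n m d l) (x : EuclideanSpace ℝ (Fin d)) : ℝ :=
  P.outer (P.inner x)

/-- Minibatch estimate `g(x, b)`; an index may occur several times in `b`. -/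
def gBatch (P : CompProblem n m d l) {B : ℕ} (x : EuclideanSpace ℝ (Fin d)) (b : Fin B → Fin m) :
    EuclideanSpace ℝ (Fin l) :=
  mean fun k => P.g (b k) x

/-- Minibatch estimate `∂g(x, b)` of the Jacobian. -/
def dgBatch (P : CompProblem n m d l) {B : ℕ} (x : EuclideanSpace ℝ (Fin d)) (b : Fin B → Fin m) :
    EuclideanSpace ℝ (Fin d) →L[ℝ] EuclideanSpace ℝ (Fin l) :=
  mean fun k => fderiv ℝ (P.g (b k)) x

/-- Minibatch estimate `∇f(y, b)` of the outer gradient. -/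
def dfBatch (P : CompProblem n m d l) {B : ℕ} (y : EuclideanSpace ℝ (Fin l)) (b : Fin B → Fin n) :
    EuclideanSpace ℝ (Fin l) :=
  mean fun k => gradient (P.f (b k)) y

end CompProblem

/-- Input parameters of STORM-Compositional (`dg` stands for `∂g`). -/
structure StormParams where
  eta : ℝ
  eps : ℝ
  ag : ℝ
  adg : ℝ
  aPhi : ℝ
  Bg : ℕ
  Bdg : ℕ
  Bf : ℕ
  Sg : ℕ
  Sdg : ℕ
  Sf : ℕ
  T : ℕ

/-- The three minibatches drawn in the initialization. -/
abbrev InitBatch (n m : ℕ) (p : StormParams) : Type :=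
  (Fin p.Sg → Fin m) × (Fin p.Sdg → Fin m) × (Fin p.Sf → Fin n)

/-- The three minibatches drawn in one iteration. -/
abbrev StepBatch (n m : ℕ) (p : StormParams) : Type :=
  (Fin p.Bg → Fin m) × (Fin p.Bdg → Fin m) × (Fin p.Bf → Fin n)

/-- All random draws of a run: the initial minibatches, those of the `T` iterations, and the
index that selects the output. It is a finite product, and a uniformly random element of it
consists of independent uniform draws: every minibatch is sampled uniformly with replacement,
all of them and the output index are independent. -/
abbrev StormDraws (n m : ℕ) (p : StormParams) : Type :=
  InitBatch n m p × (Fin p.T → StepBatch n m p) × Fin p.T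

/-- State of the algorithm: the current iterate `x`, the estimators `g`, `G`, `F`, and the list of
all component functions (`inl j` for `g j`, `inr i` for `f i`) requested from the incremental
first-order oracle so far. One entry is made for each index drawn into a minibatch; in an
iteration it covers the evaluations of that component at the old and at the new point. -/
structure StormState (n m d l : ℕ) where
  x : EuclideanSpace ℝ (Fin d)
  g : EuclideanSpace ℝ (Fin l)
  G : EuclideanSpace ℝ (Fin d) →L[ℝ] EuclideanSpace ℝ (Fin l)
  F : EuclideanSpace ℝ (Fin d)
  log : List (Fin m ⊕ Fin n)

namespace Storm

variable {n m d l : ℕ}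

/-- Oracle requests caused by drawing three minibatches. -/
def requests {A B C : ℕ} (b : (Fin A → Fin m) × (Fin B → Fin m) × (Fin C → Fin n)) :
    List (Fin m ⊕ Fin n) :=
  List.ofFn (fun k => Sum.inl (b.1 k)) ++ List.ofFn (fun k => Sum.inl (b.2.1 k)) ++
    List.ofFn (fun k => Sum.inr (b.2.2 k))

/-- Initialization. -/
def init (P : CompProblem n m d l) (p : StormParams) (x0 : EuclideanSpace ℝ (Fin d))
    (b : InitBatch n m p) : StormState n m d l :=
  let g0 := P.gBatch x0 b.1
  let G0 := P.dgBatch x0 b.2.1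
  { x := x0
    g := g0
    G := G0
    F := ContinuousLinearMap.adjoint G0 (P.dfBatch g0 b.2.2)
    log := requests b }

/-- The normalized update of the iterate. If `F = 0`, then the iterate does not move. -/
def nextX (p : StormParams) (x F : EuclideanSpace ℝ (Fin d)) : EuclideanSpace ℝ (Fin d) :=
  let xt := x - p.eta • F
  let γ := min (p.eta * p.eps / ‖xt - x‖) (1 / 2)
  x + γ • (xt - x)

/-- One iteration. -/
def step (P : CompProblem n m d l) (p : StormParams) (s : StormState n m d l)
    (b : StepBatch n m p) : StormState n m d l :=
  let x' := nextX p s.x s.F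
  let g' := (1 - p.ag) • s.g + p.ag • P.gBatch x' b.1
    + (1 - p.ag) • (P.gBatch x' b.1 - P.gBatch s.x b.1)
  let G' := (1 - p.adg) • s.G + p.adg • P.dgBatch x' b.2.1
    + (1 - p.adg) • (P.dgBatch x' b.2.1 - P.dgBatch s.x b.2.1)
  let F' := (1 - p.aPhi) • s.F
    + p.aPhi • ContinuousLinearMap.adjoint G' (P.dfBatch g' b.2.2)
    + (1 - p.aPhi) • (ContinuousLinearMap.adjoint G' (P.dfBatch g' b.2.2)
        - ContinuousLinearMap.adjoint s.G (P.dfBatch s.g b.2.2))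
  { x := x'
    g := g'
    G := G'
    F := F'
    log := s.log ++ requests b }

/-- State after `t` iterations, for `t ≤ T`. -/
def state (P : CompProblem n m d l) (p : StormParams) (x0 : EuclideanSpace ℝ (Fin d))
    (ω : StormDraws n m p) : ℕ → StormState n m d l
  | 0 => init P p x0 ω.1
  | t + 1 => if h : t < p.T then step P p (state P p x0 ω t) (ω.2.1 ⟨t, h⟩)
      else state P p x0 ω t

/-- The output: one of the iterates `x_1, …, x_T`, selected by the last draw. -/
def output (P : CompProblem n m d l) (p : StormParams) (x0 : EuclideanSpace ℝ (Fin d))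
    (ω : StormDraws n m p) : EuclideanSpace ℝ (Fin d) :=
  (state P p x0 ω (ω.2.2.val + 1)).x

/-- Total number of oracle requests of a run. -/
def ifo (P : CompProblem n m d l) (p : StormParams) (x0 : EuclideanSpace ℝ (Fin d))
    (ω : StormDraws n m p) : ℕ :=
  (state P p x0 ω p.T).log.length

end Storm

end

/-!
The draws of a run form a finite product with the uniform law, so expectations are finite means
(`mean`), and independence is the exchange of one coordinate with a fresh copy (`mean_coord`); in
particular the minibatches of an iteration are independent of the state in which it starts
(`Storm.mean_state_succ`).

*Errors of the estimates.* The three estimates `g`, `G`, `F` obey the same recursive momentum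
update `stormUpdate`, each in a Hilbert space (`frobCols` turns the Frobenius norm into one).
The error after an update is `1 - a` times the old error plus a centred minibatch mean, hence in
mean square it contracts by `1 - a` up to noise of order `1 / B`
(`mean_stormUpdate_error_le`). The noise is of two kinds: `a²` times the variance of a component,
and the mean square change of a component in one step. For `g` and `G` the latter is controlled
because a step has length at most `ε / LΦ`. For `F`, regarded as an estimate of `Gᵀ ∇f(g)`, it is
controlled by the mean square displacements of `g` and `G` (`mean_stormUpdate_sub_sq_le`), with
`‖G‖ ≤ K` throughout (`Storm.norm_G_state_le`). Summing the contractions over `t < T`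
(`mul_sum_le_of_contraction`) and using the accuracy condition gives
`∑ E ‖F t - ∇Φ (x t)‖² ≤ T ε² / 16`.

*Gradients along a trajectory.* Write `e t = F t - ∇Φ (x t)` and `L = LΦ`, a Lipschitz constant of
`∇Φ`. The descent lemma for the normalized step (`Storm.nextX_descent`) gives
`ε ‖∇Φ (x t)‖ ≤ ε² / 2 + 2 L (Φ (x t) - Φ (x (t + 1))) + (3 / 2) ‖e t‖²` and
`0 ≤ 2 L (Φ (x t) - Φ (x (t + 1))) + (1 / 2) ‖e t‖²`. The output is one of `x 1, …, x T`; the first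
bound is used for `0 < t < T`, the second for `t = 0`, and for the end point
`‖∇Φ (x T)‖² ≤ 2 L (Φ (x T) - inf Φ)`. The sum telescopes to
`ε ∑ ‖∇Φ (x t)‖ ≤ T ε² / 2 + 2 L Δ + (3 / 2) ∑ ‖e t‖²` (`Storm.sum_norm_gradient_le`), where
`2 L Δ = (3 / 16) T ε²`. In expectation the right-hand side is at most
`(1 / 2 + 3 / 16 + 3 / 32) T ε² < T ε²`.
-/

/-! ### Means over finite families -/

section Mean

variable {ι κ E F : Type*} [Fintype ι] [Fintype κ]

section Module

variable [AddCommGroup E] [Module ℝ E] [AddCommGroup F] [Module ℝ F]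

theorem mean_add (q r : ι → E) : mean (fun i => q i + r i) = mean q + mean r := by
  simp [mean, Finset.sum_add_distrib]

theorem mean_sub (q r : ι → E) : mean (fun i => q i - r i) = mean q - mean r := by
  simp [mean, Finset.sum_sub_distrib, smul_sub]

theorem mean_smul (c : ℝ) (q : ι → E) : mean (fun i => c • q i) = c • mean q := by
  simp only [mean, ← Finset.smul_sum]
  rw [smul_comm]

theorem mean_mul (c : ℝ) (q : ι → ℝ) : mean (fun i => c * q i) = c * mean q :=
  mean_smul c q

theorem mean_const [Nonempty ι] (c : E) : mean (fun _ : ι => c) = c := by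
  have h : (Fintype.card ι : ℝ) ≠ 0 := Nat.cast_ne_zero.2 Fintype.card_ne_zero
  simp only [mean, Finset.sum_const, Finset.card_univ]
  rw [← Nat.cast_smul_eq_nsmul ℝ, smul_smul, inv_mul_cancel₀ h, one_smul]

theorem map_mean (A : E →ₗ[ℝ] F) (q : ι → E) : A (mean q) = mean fun i => A (q i) := by
  simp [mean]

theorem mean_finset_sum {σ : Type*} (s : Finset σ) (q : σ → ι → E) :
    mean (fun i => ∑ t ∈ s, q t i) = ∑ t ∈ s, mean (q t) := by
  simp only [mean]
  rw [Finset.sum_comm, Finset.smul_sum]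

theorem mean_comp_equiv (e : κ ≃ ι) (q : ι → E) : mean (fun k => q (e k)) = mean q := by
  simp only [mean, Fintype.card_congr e]
  rw [Equiv.sum_comp e q]

theorem mean_prod (q : ι × κ → E) : mean q = mean fun i => mean fun k => q (i, k) := by
  simp only [mean, Fintype.card_prod, Fintype.sum_prod_type, ← Finset.smul_sum, smul_smul]
  push_cast
  rw [mul_inv]

/-- A form of Fubini's theorem: `proj ω` may be replaced by an independent copy of it in an
expression that is otherwise insensitive to the coordinate `proj ω` of `ω`. -/
theorem mean_coord [Nonempty ι] [Nonempty κ] (proj : ι → κ) (upd : ι → κ → ι)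
    (h_proj : ∀ ω b, proj (upd ω b) = b) (h_upd : ∀ ω b, upd (upd ω b) (proj ω) = ω)
    (ψ : ι → κ → E) (hψ : ∀ ω b c, ψ (upd ω b) c = ψ ω c) :
    mean (fun ω => ψ ω (proj ω)) = mean fun ω => mean fun b => ψ ω b := by
  -- Exchanging the coordinate of `ω` with the fresh copy is an involution of the product.
  have hinv : Function.Involutive (fun z : ι × κ => (upd z.1 z.2, proj z.1)) := fun z => by
    simp [h_proj, h_upd]
  rw [← mean_prod fun z : ι × κ => ψ z.1 z.2, ← mean_comp_equiv hinv.toPerm, mean_prod]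
  simp [hψ, mean_const]

end Module

theorem mean_le_mean {q r : ι → ℝ} (h : ∀ i, q i ≤ r i) : mean q ≤ mean r := by
  simp only [mean, smul_eq_mul]
  gcongr with i
  exact h i

theorem mean_nonneg {q : ι → ℝ} (h : ∀ i, 0 ≤ q i) : 0 ≤ mean q := by
  simp only [mean, smul_eq_mul]
  have := Finset.sum_nonneg fun i (_ : i ∈ Finset.univ) => h i
  positivity

theorem mean_le_of_forall_le [Nonempty ι] {q : ι → ℝ} {c : ℝ} (h : ∀ i, q i ≤ c) : mean q ≤ c :=
  (mean_le_mean h).trans (mean_const c).le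

theorem mean_fst {α β : Type*} [Fintype α] [Fintype β] [Nonempty β] (φ : α → ℝ) :
    mean (fun z : α × β => φ z.1) = mean φ := by
  rw [mean_prod]
  simp [mean_const]

theorem mean_snd {α β : Type*} [Fintype α] [Fintype β] [Nonempty α] (φ : β → ℝ) :
    mean (fun z : α × β => φ z.2) = mean φ := by
  rw [mean_prod]
  simp [mean_const]

theorem norm_mean_le [SeminormedAddCommGroup E] [NormedSpace ℝ E] [Nonempty ι] {q : ι → E} {c : ℝ}
    (h : ∀ i, ‖q i‖ ≤ c) : ‖mean q‖ ≤ c := by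
  refine le_trans ?_ (mean_le_of_forall_le h)
  simp only [mean, norm_smul, norm_inv, Real.norm_natCast, smul_eq_mul]
  gcongr
  exact norm_sum_le _ _

end Mean

/-! ### Second moments of minibatch estimates -/

theorem norm_add_add_sq_le {E : Type*} [SeminormedAddCommGroup E] (a b c : E) :
    ‖a + b + c‖ ^ 2 ≤ 3 * ‖a‖ ^ 2 + 3 * ‖b‖ ^ 2 + 3 * ‖c‖ ^ 2 := by
  have h : ‖a + b + c‖ ^ 2 ≤ (‖a‖ + ‖b‖ + ‖c‖) ^ 2 := by
    gcongr
    exact norm_add₃_le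
  nlinarith [sq_nonneg (‖a‖ - ‖b‖), sq_nonneg (‖a‖ - ‖c‖), sq_nonneg (‖b‖ - ‖c‖)]

section Minibatch

variable {ι H : Type*} [Fintype ι] [Nonempty ι] [NormedAddCommGroup H] [InnerProductSpace ℝ H]

theorem norm_add_sq_le (a b : H) : ‖a + b‖ ^ 2 ≤ 2 * ‖a‖ ^ 2 + 2 * ‖b‖ ^ 2 := by
  have := parallelogram_law_with_norm ℝ a b
  nlinarith [sq_nonneg ‖a - b‖]

theorem mean_norm_add_sq (u : H) (z : ι → H) :
    mean (fun i => ‖u + z i‖ ^ 2) =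
      ‖u‖ ^ 2 + 2 * inner ℝ u (mean z) + mean fun i => ‖z i‖ ^ 2 := by
  simp only [norm_add_sq_real, mean_add, mean_const]
  rw [mean_mul, ← innerₛₗ_apply_apply (𝕜 := ℝ) u (mean z), map_mean]
  simp

theorem mean_norm_sub_mean_sq_le (z : ι → H) :
    mean (fun i => ‖z i - mean z‖ ^ 2) ≤ mean fun i => ‖z i‖ ^ 2 := by
  have h := mean_norm_add_sq (-mean z) z
  simp only [neg_add_eq_sub, norm_neg, inner_neg_left, real_inner_self_eq_norm_sq] at h
  nlinarith [sq_nonneg ‖mean z‖]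

/-- Independent centred summands are orthogonal in mean square. -/
theorem mean_norm_add_sum_sq (z : ι → H) (hz : mean z = 0) (B : ℕ) (u : H) :
    mean (fun b : Fin B → ι => ‖u + ∑ k, z (b k)‖ ^ 2) =
      ‖u‖ ^ 2 + B * mean fun i => ‖z i‖ ^ 2 := by
  induction B generalizing u with
  | zero => simp [mean_const]
  | succ B ih =>
    rw [← mean_comp_equiv (Fin.consEquiv fun _ : Fin (B + 1) => ι), mean_prod]
    simp only [Fin.consEquiv_apply, Fin.sum_univ_succ, Fin.cons_zero, Fin.cons_succ, ← add_assoc,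
      ih, mean_add, mean_const, mean_norm_add_sq, hz, inner_zero_right]
    push_cast
    ring

theorem mean_norm_add_batch_sq (z : ι → H) (hz : mean z = 0) {B : ℕ} (hB : 0 < B) (u : H) :
    mean (fun b : Fin B → ι => ‖u + mean fun k => z (b k)‖ ^ 2) =
      ‖u‖ ^ 2 + (mean fun i => ‖z i‖ ^ 2) / B := by
  have hB' : (B : ℝ) ≠ 0 := by positivity
  have h := mean_norm_add_sum_sq (fun i => (B : ℝ)⁻¹ • z i) (by rw [mean_smul, hz, smul_zero]) B u
  simp only [← Finset.smul_sum, norm_smul, mul_pow, mean_mul, norm_inv, Real.norm_natCast] at h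
  simp only [mean, Fintype.card_fin] at h ⊢
  rw [h]
  field_simp

theorem mean_batch_sub_sq (q : ι → H) {B : ℕ} (hB : 0 < B) :
    mean (fun b : Fin B → ι => ‖(mean fun k => q (b k)) - mean q‖ ^ 2) =
      (mean fun i => ‖q i - mean q‖ ^ 2) / B := by
  have : Nonempty (Fin B) := ⟨⟨0, hB⟩⟩
  have h := mean_norm_add_batch_sq (fun i => q i - mean q) (by simp [mean_sub, mean_const]) hB 0
  simpa [mean_sub, mean_const] using h

/-- The recursive momentum (STORM) update of an estimate `u`: `p` and `q` are the minibatch values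
at the old and at the new point. -/
noncomputable def stormUpdate {E : Type*} [AddCommGroup E] [Module ℝ E] (a : ℝ) (u p q : E) : E :=
  (1 - a) • u + a • q + (1 - a) • (q - p)

/-- The error of a STORM estimate contracts by `1 - a`, up to sampling noise. -/
theorem mean_stormUpdate_error_le (u : H) (p q : ι → H) {a V D : ℝ} (ha0 : 0 ≤ a) (ha1 : a ≤ 1)
    (hV : mean (fun i => ‖q i - mean q‖ ^ 2) ≤ V) (hD : mean (fun i => ‖q i - p i‖ ^ 2) ≤ D)
    {B : ℕ} (hB : 0 < B) :
    mean (fun b : Fin B → ι =>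
        ‖stormUpdate a u (mean fun k => p (b k)) (mean fun k => q (b k)) - mean q‖ ^ 2) ≤
      (1 - a) * ‖u - mean p‖ ^ 2 + (2 * a ^ 2 * V + 2 * D) / B := by
  have : Nonempty (Fin B) := ⟨⟨0, hB⟩⟩
  set z : ι → H := fun i =>
    a • (q i - mean q) + (1 - a) • ((q i - p i) - mean fun i => q i - p i) with hz
  have hz0 : mean z = 0 := by
    simp only [hz, mean_add, mean_smul, mean_sub, mean_const]
    simp
  have hsplit : ∀ b : Fin B → ι,
      stormUpdate a u (mean fun k => p (b k)) (mean fun k => q (b k)) - mean q =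
        (1 - a) • (u - mean p) + mean fun k => z (b k) := fun b => by
    simp only [hz, mean_add, mean_smul, mean_sub, mean_const, stormUpdate]
    module
  have hzV : mean (fun i => ‖z i‖ ^ 2) ≤ 2 * a ^ 2 * V + 2 * D := by
    have h1 : ∀ i, ‖z i‖ ^ 2 ≤ 2 * a ^ 2 * ‖q i - mean q‖ ^ 2 +
        2 * (1 - a) ^ 2 * ‖(q i - p i) - mean fun i => q i - p i‖ ^ 2 := fun i => by
      refine (norm_add_sq_le _ _).trans_eq ?_
      simp only [norm_smul, mul_pow, Real.norm_eq_abs, sq_abs]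
      ring
    have h2 := mean_norm_sub_mean_sq_le fun i => q i - p i
    have h3 := mean_le_mean h1
    rw [mean_add, mean_mul, mean_mul] at h3
    have h4 : 0 ≤ mean fun i => ‖q i - p i‖ ^ 2 := mean_nonneg fun i => sq_nonneg _
    have h5 : (1 - a) ^ 2 ≤ 1 := by nlinarith
    have h7 := mean_nonneg fun i => sq_nonneg ‖(q i - p i) - mean fun i => q i - p i‖
    have h6 : (1 - a) ^ 2 * mean (fun i => ‖(q i - p i) - mean fun i => q i - p i‖ ^ 2) ≤ D := by
      calc _ ≤ 1 * mean (fun i => ‖q i - p i‖ ^ 2) := by gcongr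
        _ ≤ D := by rwa [one_mul]
    nlinarith [mul_le_mul_of_nonneg_left hV (sq_nonneg a)]
  simp only [hsplit]
  rw [mean_norm_add_batch_sq z hz0 hB, norm_smul, mul_pow, Real.norm_eq_abs, sq_abs]
  gcongr
  nlinarith

/-- The mean square displacement of a STORM estimate in one update. -/
theorem mean_stormUpdate_sub_sq_le (u : H) (p q : ι → H) {a V c : ℝ}
    (hV : mean (fun i => ‖p i - mean p‖ ^ 2) ≤ V) (hc : ∀ i, ‖q i - p i‖ ≤ c)
    {B : ℕ} (hB : 0 < B) :
    mean (fun b : Fin B → ι =>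
        ‖stormUpdate a u (mean fun k => p (b k)) (mean fun k => q (b k)) - u‖ ^ 2) ≤
      3 * a ^ 2 * ‖u - mean p‖ ^ 2 + 3 * c ^ 2 + 3 * a ^ 2 * V / B := by
  have : Nonempty (Fin B) := ⟨⟨0, hB⟩⟩
  have h1 : ∀ b : Fin B → ι,
      ‖stormUpdate a u (mean fun k => p (b k)) (mean fun k => q (b k)) - u‖ ^ 2 ≤
        3 * a ^ 2 * ‖u - mean p‖ ^ 2 + 3 * c ^ 2 +
          3 * a ^ 2 * ‖(mean fun k => p (b k)) - mean p‖ ^ 2 := fun b => by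
    have e : stormUpdate a u (mean fun k => p (b k)) (mean fun k => q (b k)) - u =
        -(a • (u - mean p)) + (mean fun k => q (b k) - p (b k)) +
          a • ((mean fun k => p (b k)) - mean p) := by
      simp only [mean_sub, stormUpdate]
      module
    have h2 : ‖mean fun k => q (b k) - p (b k)‖ ≤ c := norm_mean_le fun k => hc _
    rw [e]
    refine (norm_add_add_sq_le _ _ _).trans ?_
    simp only [norm_neg, norm_smul, mul_pow, Real.norm_eq_abs, sq_abs]
    have h3 : ‖mean fun k => q (b k) - p (b k)‖ ^ 2 ≤ c ^ 2 := by gcongr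
    linarith
  refine (mean_le_mean h1).trans ?_
  rw [mean_add, mean_const, mean_mul, mean_batch_sub_sq p hB, mul_div_assoc]
  gcongr

/-- Summation of a perturbed linear contraction. -/
theorem mul_sum_le_of_contraction {u c : ℕ → ℝ} {a : ℝ} {T : ℕ} (hu : ∀ t, 0 ≤ u t)
    (h : ∀ t < T, u (t + 1) ≤ (1 - a) * u t + c t) :
    a * ∑ t ∈ Finset.range T, u t ≤ u 0 + ∑ t ∈ Finset.range T, c t := by
  have key : ∀ N ≤ T, u N + a * ∑ t ∈ Finset.range N, u t ≤ u 0 + ∑ t ∈ Finset.range N, c t := by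
    intro N
    induction N with
    | zero => simp
    | succ N ih =>
      intro hN
      rw [Finset.sum_range_succ, Finset.sum_range_succ]
      linarith [ih (by omega), h N (by omega)]
  linarith [key T le_rfl, hu T]

end Minibatch

/-! ### Descent for smooth functions -/

section Descent

variable {E : Type*} [NormedAddCommGroup E] [InnerProductSpace ℝ E] [CompleteSpace E]

theorem descent_lemma {Φ : E → ℝ} (hΦ : Differentiable ℝ Φ) {L : ℝ}
    (hL : ∀ x y, ‖gradient Φ x - gradient Φ y‖ ≤ L * ‖x - y‖) (x s : E) :
    Φ (x + s) ≤ Φ x + inner ℝ (gradient Φ x) s + L / 2 * ‖s‖ ^ 2 := by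
  set h : ℝ → ℝ := fun r => Φ (x + r • s) - r * inner ℝ (gradient Φ x) s - r ^ 2 * (L / 2 * ‖s‖ ^ 2)
    with hh
  have hd : ∀ r, HasDerivAt h (inner ℝ (gradient Φ (x + r • s)) s - inner ℝ (gradient Φ x) s
      - 2 * r * (L / 2 * ‖s‖ ^ 2)) r := fun r => by
    have h1 : HasDerivAt (fun r : ℝ => x + r • s) s r := by
      simpa using ((hasDerivAt_id r).smul_const s).const_add x
    have h2 : HasDerivAt (fun r : ℝ => Φ (x + r • s)) (fderiv ℝ Φ (x + r • s) s) r :=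
      (hΦ (x + r • s)).hasFDerivAt.comp_hasDerivAt r h1
    rw [inner_gradient_left]
    have h3 := (hasDerivAt_id r).mul_const (inner ℝ (gradient Φ x) s)
    have h4 := ((hasDerivAt_id r).pow 2).mul_const (L / 2 * ‖s‖ ^ 2)
    exact ((h2.sub h3).sub h4).congr_deriv (by simp)
  have hanti : AntitoneOn h (Set.Icc 0 1) := by
    refine antitoneOn_of_deriv_nonpos (convex_Icc 0 1)
      (fun r _ => (hd r).continuousAt.continuousWithinAt)
      (fun r _ => (hd r).differentiableAt.differentiableWithinAt) fun r hr => ?_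
    rw [interior_Icc] at hr
    rw [(hd r).deriv, ← inner_sub_left]
    have h1 := real_inner_le_norm (gradient Φ (x + r • s) - gradient Φ x) s
    have h2 := hL (x + r • s) x
    rw [add_sub_cancel_left, norm_smul, Real.norm_eq_abs, abs_of_pos hr.1] at h2
    nlinarith [mul_le_mul_of_nonneg_right h2 (norm_nonneg s)]
  have := hanti (Set.left_mem_Icc.2 zero_le_one) (Set.right_mem_Icc.2 zero_le_one) zero_le_one
  simp only [hh, one_smul, zero_smul, add_zero] at this
  linarith

theorem norm_gradient_sq_le {Φ : E → ℝ} (hΦ : Differentiable ℝ Φ) {L : ℝ} (hL0 : 0 < L)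
    (hL : ∀ x y, ‖gradient Φ x - gradient Φ y‖ ≤ L * ‖x - y‖)
    (hbdd : BddBelow (Set.range Φ)) (x : E) :
    ‖gradient Φ x‖ ^ 2 ≤ 2 * L * (Φ x - ⨅ y, Φ y) := by
  have h1 := descent_lemma hΦ hL x (-(1 / L) • gradient Φ x)
  have h2 := ciInf_le hbdd (x + -(1 / L) • gradient Φ x)
  rw [inner_smul_right, real_inner_self_eq_norm_sq, norm_smul, mul_pow, Real.norm_eq_abs, sq_abs]
    at h1
  have h3 : L / 2 * ((-(1 / L)) ^ 2 * ‖gradient Φ x‖ ^ 2) = ‖gradient Φ x‖ ^ 2 / (2 * L) := by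
    field_simp
  have h4 : -(1 / L) * ‖gradient Φ x‖ ^ 2 = -(2 * (‖gradient Φ x‖ ^ 2 / (2 * L))) := by
    field_simp
  have h5 : ‖gradient Φ x‖ ^ 2 / (2 * L) ≤ Φ x - ⨅ y, Φ y := by linarith
  rw [div_le_iff₀ (by positivity)] at h5
  linarith

end Descent

/-! ### Gradient bounds along normalized inexact gradient steps -/

section NormalizedStep

variable {d : ℕ}

theorem Storm.nextX_eq (p : StormParams) {L : ℝ} (hL0 : 0 < L) (hη : p.eta = 1 / L)
    (hε : 0 < p.eps) (x F : EuclideanSpace ℝ (Fin d)) :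
    (‖F‖ ≤ 2 * p.eps ∧ Storm.nextX p x F = x + (-(1 / (2 * L))) • F) ∨
      (2 * p.eps < ‖F‖ ∧ Storm.nextX p x F = x + (-(p.eps / (L * ‖F‖))) • F) := by
  have e : x - p.eta • F - x = (-(1 / L)) • F := by rw [hη]; module
  have hn : ‖x - p.eta • F - x‖ = ‖F‖ / L := by
    rw [e, norm_smul, norm_neg, Real.norm_eq_abs, abs_of_pos (by positivity)]
    ring
  have hq : p.eta * p.eps / ‖x - p.eta • F - x‖ = p.eps / ‖F‖ := by
    rw [hn, hη]
    field_simp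
  have hx : Storm.nextX p x F = x + (min (p.eps / ‖F‖) (1 / 2) * -(1 / L)) • F := by
    simp only [Storm.nextX]
    rw [hq, e, smul_smul]
  rcases eq_or_ne F 0 with rfl | hF
  · left
    constructor
    · rw [norm_zero]
      positivity
    · rw [hx]
      simp
  have hF' : 0 < ‖F‖ := norm_pos_iff.2 hF
  rcases le_or_gt ‖F‖ (2 * p.eps) with h | h
  · refine Or.inl ⟨h, ?_⟩
    rw [hx, min_eq_right]
    · congr 2
      field_simp
    · rw [le_div_iff₀ hF']
      linarith
  · refine Or.inr ⟨h, ?_⟩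
    rw [hx, min_eq_left]
    · congr 2
      field_simp
    · rw [div_le_iff₀ hF']
      linarith

theorem Storm.norm_nextX_sub_le (p : StormParams) {L : ℝ} (hL0 : 0 < L) (hη : p.eta = 1 / L)
    (hε : 0 < p.eps) (x F : EuclideanSpace ℝ (Fin d)) :
    ‖Storm.nextX p x F - x‖ ≤ p.eps / L := by
  rcases Storm.nextX_eq p hL0 hη hε x F with ⟨h, e⟩ | ⟨h, e⟩
  · rw [e, add_sub_cancel_left, norm_smul, norm_neg, Real.norm_eq_abs, abs_of_pos (by positivity),
      div_mul_eq_mul_div, div_le_div_iff₀ (by positivity) hL0]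
    nlinarith
  · have hF : 0 < ‖F‖ := by linarith
    rw [e, add_sub_cancel_left, norm_smul, norm_neg, Real.norm_eq_abs, abs_of_pos (by positivity)]
    apply le_of_eq
    field_simp

/-- One normalized step along an inexact gradient `F`. The first bound controls the gradient at the
starting point by the decrease of `Φ`; the second one says that `Φ` cannot increase by more than a
multiple of the squared error of `F`. -/
theorem Storm.nextX_descent {Φ : EuclideanSpace ℝ (Fin d) → ℝ} (hΦ : Differentiable ℝ Φ) {L : ℝ}
    (hL0 : 0 < L) (hL : ∀ x y, ‖gradient Φ x - gradient Φ y‖ ≤ L * ‖x - y‖)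
    (p : StormParams) (hη : p.eta = 1 / L) (hε : 0 < p.eps) (x F : EuclideanSpace ℝ (Fin d)) :
    p.eps * ‖gradient Φ x‖ ≤ p.eps ^ 2 / 2 + 2 * L * (Φ x - Φ (Storm.nextX p x F))
        + 3 / 2 * ‖F - gradient Φ x‖ ^ 2 ∧
      0 ≤ 2 * L * (Φ x - Φ (Storm.nextX p x F)) + 1 / 2 * ‖F - gradient Φ x‖ ^ 2 := by
  set ε := p.eps
  set v := gradient Φ x
  set e := F - v with he
  have hF : F = v + e := by rw [he]; abel
  have hve := abs_le.1 (abs_real_inner_le_norm v e)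
  have hv0 := norm_nonneg v
  have he0 := norm_nonneg e
  rcases Storm.nextX_eq p hL0 hη hε x F with ⟨h, hx⟩ | ⟨h, hx⟩
  · have hd := descent_lemma hΦ hL x ((-(1 / (2 * L))) • F)
    rw [← hx, inner_smul_right, norm_smul, mul_pow, Real.norm_eq_abs, sq_abs] at hd
    have h1 : 2 * L * (-(1 / (2 * L)) * inner ℝ v F + L / 2 * ((-(1 / (2 * L))) ^ 2 * ‖F‖ ^ 2)) =
        -inner ℝ v F + ‖F‖ ^ 2 / 4 := by
      field_simp
      ring
    have h2 : inner ℝ v F - ‖F‖ ^ 2 / 4 ≤ 2 * L * (Φ x - Φ (Storm.nextX p x F)) := by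
      have := mul_le_mul_of_nonneg_left hd (by positivity : (0 : ℝ) ≤ 2 * L)
      linarith
    have h3 : inner ℝ v F = ‖v‖ ^ 2 + inner ℝ v e := by
      rw [hF, inner_add_right, real_inner_self_eq_norm_sq]
    have h4 : ‖F‖ ^ 2 = ‖v‖ ^ 2 + 2 * inner ℝ v e + ‖e‖ ^ 2 := by
      rw [hF, norm_add_sq_real]
    rw [h3, h4] at h2
    constructor
    · nlinarith [sq_nonneg (ε - ‖v‖), sq_nonneg (‖v‖ - ‖e‖), sq_nonneg ‖e‖]
    · nlinarith [sq_nonneg (‖v‖ - ‖e‖), sq_nonneg ‖v‖]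
  · have hd := descent_lemma hΦ hL x ((-(ε / (L * ‖F‖))) • F)
    have hr : 0 < ‖F‖ := by linarith
    rw [← hx, inner_smul_right, norm_smul, mul_pow, Real.norm_eq_abs, sq_abs] at hd
    have h1 : 2 * L * (-(ε / (L * ‖F‖)) * inner ℝ v F +
        L / 2 * ((-(ε / (L * ‖F‖))) ^ 2 * ‖F‖ ^ 2)) =
        -(2 * ε / ‖F‖) * inner ℝ v F + ε ^ 2 := by
      field_simp
    have h2 : ‖F‖ - ‖e‖ ≤ inner ℝ v F / ‖F‖ := by
      rw [le_div_iff₀ hr]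
      have h3 : v = F - e := by rw [he]; abel
      have h4 := real_inner_le_norm e F
      rw [h3, inner_sub_left, real_inner_self_eq_norm_sq]
      linarith
    have h5 : 2 * ε * (‖F‖ - ‖e‖) - ε ^ 2 ≤ 2 * L * (Φ x - Φ (Storm.nextX p x F)) := by
      have h6 := mul_le_mul_of_nonneg_left hd (by positivity : (0 : ℝ) ≤ 2 * L)
      have h7 := mul_le_mul_of_nonneg_left h2 (by positivity : (0 : ℝ) ≤ 2 * ε)
      have h8 : 2 * ε / ‖F‖ * inner ℝ v F = 2 * ε * (inner ℝ v F / ‖F‖) := by ring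
      linarith
    have h9 : ‖v‖ ≤ ‖F‖ + ‖e‖ := by
      have h3 : v = F - e := by rw [he]; abel
      rw [h3]
      exact norm_sub_le _ _
    have h10 := mul_le_mul_of_nonneg_left h9 hε.le
    have h11 := mul_le_mul_of_nonneg_left h.le hε.le
    constructor
    · nlinarith [sq_nonneg (ε - ‖e‖)]
    · nlinarith [sq_nonneg (2 * ε - ‖e‖), sq_nonneg ε]

/-- The gradients at the points *after* each step. The point reached by the last step starts no
further step; its gradient is bounded by the gap that is left there. -/
theorem Storm.sum_norm_gradient_le {Φ : EuclideanSpace ℝ (Fin d) → ℝ} (hΦ : Differentiable ℝ Φ)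
    {L : ℝ} (hL0 : 0 < L) (hL : ∀ x y, ‖gradient Φ x - gradient Φ y‖ ≤ L * ‖x - y‖)
    (hbdd : BddBelow (Set.range Φ)) (p : StormParams) (hη : p.eta = 1 / L) (hε : 0 < p.eps)
    (x F : ℕ → EuclideanSpace ℝ (Fin d)) {T : ℕ} (hT : 0 < T)
    (hx : ∀ t < T, x (t + 1) = Storm.nextX p (x t) (F t)) :
    p.eps * ∑ t ∈ Finset.range T, ‖gradient Φ (x (t + 1))‖ ≤
      T * (p.eps ^ 2 / 2) + 2 * L * (Φ (x 0) - ⨅ y, Φ y)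
        + 3 / 2 * ∑ t ∈ Finset.range T, ‖F t - gradient Φ (x t)‖ ^ 2 := by
  obtain ⟨M, rfl⟩ : ∃ M, T = M + 1 := ⟨T - 1, by omega⟩
  have h0 := (Storm.nextX_descent hΦ hL0 hL p hη hε (x 0) (F 0)).2
  rw [← hx 0 hT] at h0
  have hmid : ∑ t ∈ Finset.range M, p.eps * ‖gradient Φ (x (t + 1))‖ ≤
      ∑ t ∈ Finset.range M, (p.eps ^ 2 / 2 + 2 * L * (Φ (x (t + 1)) - Φ (x (t + 1 + 1)))
        + 3 / 2 * ‖F (t + 1) - gradient Φ (x (t + 1))‖ ^ 2) := by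
    refine Finset.sum_le_sum fun t ht => ?_
    rw [Finset.mem_range] at ht
    rw [hx (t + 1) (by omega)]
    exact (Storm.nextX_descent hΦ hL0 hL p hη hε (x (t + 1)) (F (t + 1))).1
  rw [Finset.sum_add_distrib, Finset.sum_add_distrib, ← Finset.mul_sum, ← Finset.mul_sum,
    ← Finset.mul_sum, Finset.sum_range_sub' (fun t => Φ (x (t + 1))), Finset.sum_const,
    Finset.card_range, nsmul_eq_mul] at hmid
  have hlast := norm_gradient_sq_le hΦ hL0 hL hbdd (x (M + 1))
  have hinf := ciInf_le hbdd (x (M + 1))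
  rw [Finset.sum_range_succ, Finset.sum_range_succ' (fun t => ‖F t - gradient Φ (x t)‖ ^ 2)]
  push_cast
  simp only [zero_add] at hmid
  have hLpos : 0 ≤ L * (Φ (x (M + 1)) - ⨅ y, Φ y) :=
    mul_nonneg hL0.le (sub_nonneg.2 hinf)
  nlinarith [sq_nonneg (p.eps - ‖gradient Φ (x (M + 1))‖), sq_nonneg ‖F 0 - gradient Φ (x 0)‖]

end NormalizedStep

/-! ### The Frobenius norm -/

section Frobenius

variable {d l : ℕ}

/-- The columns of a linear map, as an element of a Euclidean product. This embedding carries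
the Frobenius norm to a Hilbert space norm. -/
noncomputable def frobCols : (EuclideanSpace ℝ (Fin d) →L[ℝ] EuclideanSpace ℝ (Fin l)) →ₗ[ℝ]
    PiLp 2 fun _ : Fin d => EuclideanSpace ℝ (Fin l) where
  toFun A := WithLp.toLp 2 fun k => A (EuclideanSpace.single k 1)
  map_add' A B := by ext; simp
  map_smul' c A := by ext; simp

theorem norm_frobCols (A : EuclideanSpace ℝ (Fin d) →L[ℝ] EuclideanSpace ℝ (Fin l)) :
    ‖frobCols A‖ = frobNorm A := by
  simp [frobCols, frobNorm, PiLp.norm_eq_of_L2]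

theorem frobNorm_nonneg (A : EuclideanSpace ℝ (Fin d) →L[ℝ] EuclideanSpace ℝ (Fin l)) :
    0 ≤ frobNorm A :=
  Real.sqrt_nonneg _

theorem norm_le_frobNorm (A : EuclideanSpace ℝ (Fin d) →L[ℝ] EuclideanSpace ℝ (Fin l)) :
    ‖A‖ ≤ frobNorm A := by
  refine A.opNorm_le_bound (frobNorm_nonneg A) fun x => ?_
  have hx : A x = ∑ k, x k • A (EuclideanSpace.single k 1) := by
    conv_lhs => rw [← (EuclideanSpace.basisFun (Fin d) ℝ).sum_repr x]
    simp
  calc ‖A x‖ ≤ ∑ k, ‖x k‖ * ‖A (EuclideanSpace.single k 1)‖ := by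
        rw [hx]
        exact (norm_sum_le _ _).trans_eq (by simp [norm_smul])
    _ ≤ Real.sqrt (∑ k, ‖x k‖ ^ 2) * Real.sqrt (∑ k, ‖A (EuclideanSpace.single k 1)‖ ^ 2) :=
        Real.sum_mul_le_sqrt_mul_sqrt _ _ _
    _ = frobNorm A * ‖x‖ := by rw [EuclideanSpace.norm_eq, frobNorm, mul_comm]

end Frobenius

/-! ### Smoothness of the composite objective -/

namespace CompProblem

variable {n m d l : ℕ}

theorem hasGradientAt_outer {P : CompProblem n m d l} (hf : ∀ i, Differentiable ℝ (P.f i))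
    (y : EuclideanSpace ℝ (Fin l)) :
    HasGradientAt P.outer (mean fun i => gradient (P.f i) y) y := by
  rw [hasGradientAt_iff_hasFDerivAt]
  have h := (HasFDerivAt.fun_sum fun i (_ : i ∈ Finset.univ) =>
    (hf i y).hasFDerivAt).const_smul ((Fintype.card (Fin n) : ℝ)⁻¹)
  refine h.congr_fderiv ?_
  simp [mean, gradient]

theorem hasFDerivAt_inner {P : CompProblem n m d l} (hg : ∀ j, Differentiable ℝ (P.g j))
    (x : EuclideanSpace ℝ (Fin d)) :
    HasFDerivAt P.inner (mean fun j => fderiv ℝ (P.g j) x) x :=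
  (HasFDerivAt.fun_sum fun j (_ : j ∈ Finset.univ) =>
    (hg j x).hasFDerivAt).const_smul ((Fintype.card (Fin m) : ℝ)⁻¹)

theorem hasGradientAt_Phi {P : CompProblem n m d l} (hf : ∀ i, Differentiable ℝ (P.f i))
    (hg : ∀ j, Differentiable ℝ (P.g j)) (x : EuclideanSpace ℝ (Fin d)) :
    HasGradientAt P.Phi
      (ContinuousLinearMap.adjoint (fderiv ℝ P.inner x) (gradient P.outer (P.inner x))) x := by
  rw [hasGradientAt_iff_hasFDerivAt]
  have h := (hasGradientAt_outer hf (P.inner x)).differentiableAt.hasFDerivAt.comp x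
    (hasFDerivAt_inner hg x).differentiableAt.hasFDerivAt
  refine h.congr_fderiv ?_
  ext v
  simp [ContinuousLinearMap.adjoint_inner_left]

/-- The smoothness, boundedness and variance assumptions on a finite-sum compositional problem. -/
structure Regular (P : CompProblem n m d l) (Lf Lg Mf Mg H1 H2 H3 : ℝ) : Prop where
  card_f : 0 < n
  card_g : 0 < m
  diff_f : ∀ i, Differentiable ℝ (P.f i)
  diff_g : ∀ j, Differentiable ℝ (P.g j)
  Lf_nonneg : 0 ≤ Lf
  Lg_nonneg : 0 ≤ Lg
  Mf_pos : 0 < Mf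
  Mg_pos : 0 < Mg
  lip_g : ∀ j x x', frobNorm (fderiv ℝ (P.g j) x - fderiv ℝ (P.g j) x') ≤ Lg * ‖x - x'‖
  lip_f : ∀ i y y', ‖gradient (P.f i) y - gradient (P.f i) y'‖ ≤ Lf * ‖y - y'‖
  bound_g : ∀ j x, ‖fderiv ℝ (P.g j) x‖ ≤ Mg
  bound_f : ∀ i y, ‖gradient (P.f i) y‖ ≤ Mf
  var_f : ∀ y, mean (fun i => ‖gradient (P.f i) y - gradient P.outer y‖ ^ 2) ≤ H1
  var_dg : ∀ x, mean (fun j => frobNorm (fderiv ℝ (P.g j) x - fderiv ℝ P.inner x) ^ 2) ≤ H2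
  var_g : ∀ x, mean (fun j => ‖P.g j x - P.inner x‖ ^ 2) ≤ H3

namespace Regular

variable {P : CompProblem n m d l} {Lf Lg Mf Mg H1 H2 H3 : ℝ}

section

variable (h : P.Regular Lf Lg Mf Mg H1 H2 H3)
include h

theorem gradient_outer (y : EuclideanSpace ℝ (Fin l)) :
    gradient P.outer y = mean fun i => gradient (P.f i) y :=
  (hasGradientAt_outer h.diff_f y).gradient

theorem fderiv_inner (x : EuclideanSpace ℝ (Fin d)) :
    fderiv ℝ P.inner x = mean fun j => fderiv ℝ (P.g j) x :=
  (hasFDerivAt_inner h.diff_g x).fderiv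

theorem gradient_Phi (x : EuclideanSpace ℝ (Fin d)) :
    gradient P.Phi x =
      ContinuousLinearMap.adjoint (fderiv ℝ P.inner x) (gradient P.outer (P.inner x)) :=
  (hasGradientAt_Phi h.diff_f h.diff_g x).gradient

theorem differentiable_Phi : Differentiable ℝ P.Phi := fun x =>
  (hasGradientAt_Phi h.diff_f h.diff_g x).differentiableAt

theorem nonempty_f : Nonempty (Fin n) := ⟨⟨0, h.card_f⟩⟩

theorem nonempty_g : Nonempty (Fin m) := ⟨⟨0, h.card_g⟩⟩

theorem norm_gradient_outer_le (y : EuclideanSpace ℝ (Fin l)) : ‖gradient P.outer y‖ ≤ Mf := by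
  have := h.nonempty_f
  rw [h.gradient_outer]
  exact norm_mean_le fun i => h.bound_f i y

theorem norm_gradient_outer_sub_le (y y' : EuclideanSpace ℝ (Fin l)) :
    ‖gradient P.outer y - gradient P.outer y'‖ ≤ Lf * ‖y - y'‖ := by
  have := h.nonempty_f
  rw [h.gradient_outer, h.gradient_outer, ← mean_sub]
  exact norm_mean_le fun i => h.lip_f i y y'

theorem norm_fderiv_inner_le (x : EuclideanSpace ℝ (Fin d)) : ‖fderiv ℝ P.inner x‖ ≤ Mg := by
  have := h.nonempty_g
  rw [h.fderiv_inner]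
  exact norm_mean_le fun j => h.bound_g j x

theorem norm_fderiv_inner_sub_le (x x' : EuclideanSpace ℝ (Fin d)) :
    ‖fderiv ℝ P.inner x - fderiv ℝ P.inner x'‖ ≤ Lg * ‖x - x'‖ := by
  have := h.nonempty_g
  rw [h.fderiv_inner, h.fderiv_inner, ← mean_sub]
  exact norm_mean_le fun j => (norm_le_frobNorm _).trans (h.lip_g j x x')

theorem norm_g_sub_le (j : Fin m) (x x' : EuclideanSpace ℝ (Fin d)) :
    ‖P.g j x - P.g j x'‖ ≤ Mg * ‖x - x'‖ :=
  convex_univ.norm_image_sub_le_of_norm_fderiv_le (fun z _ => h.diff_g j z)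
    (fun z _ => h.bound_g j z) (Set.mem_univ x') (Set.mem_univ x)

theorem norm_inner_sub_le (x x' : EuclideanSpace ℝ (Fin d)) :
    ‖P.inner x - P.inner x'‖ ≤ Mg * ‖x - x'‖ := by
  have := h.nonempty_g
  simp only [CompProblem.inner]
  rw [← mean_sub]
  exact norm_mean_le fun j => h.norm_g_sub_le j x x'

end

/-- Perturbation of a product `Aᵀ v`. -/
theorem norm_adjoint_sub_le (A A' : EuclideanSpace ℝ (Fin d) →L[ℝ] EuclideanSpace ℝ (Fin l))
    (v v' : EuclideanSpace ℝ (Fin l)) :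
    ‖ContinuousLinearMap.adjoint A' v' - ContinuousLinearMap.adjoint A v‖ ≤
      ‖A' - A‖ * ‖v'‖ + ‖A‖ * ‖v' - v‖ := by
  have e : ContinuousLinearMap.adjoint A' v' - ContinuousLinearMap.adjoint A v =
      ContinuousLinearMap.adjoint (A' - A) v' + ContinuousLinearMap.adjoint A (v' - v) := by
    simp [map_sub]
  rw [e]
  refine norm_add_le_of_le ?_ ?_
  · exact ((ContinuousLinearMap.adjoint (A' - A)).le_opNorm v').trans_eq
      (by rw [LinearIsometryEquiv.norm_map])
  · exact ((ContinuousLinearMap.adjoint A).le_opNorm (v' - v)).trans_eq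
      (by rw [LinearIsometryEquiv.norm_map])

theorem norm_gradient_Phi_sub_le (h : P.Regular Lf Lg Mf Mg H1 H2 H3)
    (x x' : EuclideanSpace ℝ (Fin d)) :
    ‖gradient P.Phi x - gradient P.Phi x'‖ ≤ (Mf * Lg + Mg ^ 2 * Lf) * ‖x - x'‖ := by
  rw [h.gradient_Phi, h.gradient_Phi]
  have hMg := h.Mg_pos
  have hMf := h.Mf_pos
  have hLf := h.Lf_nonneg
  have hLg := h.Lg_nonneg
  calc _ ≤ Lg * ‖x - x'‖ * Mf + Mg * (Lf * (Mg * ‖x - x'‖)) := by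
        refine (norm_adjoint_sub_le _ _ _ _).trans ?_
        gcongr
        · exact h.norm_fderiv_inner_sub_le x x'
        · exact h.norm_gradient_outer_le _
        · exact h.norm_fderiv_inner_le x'
        · refine (h.norm_gradient_outer_sub_le _ _).trans ?_
          gcongr
          exact h.norm_inner_sub_le x x'
    _ = _ := by ring

end Regular

end CompProblem

/-! ### One iteration -/

namespace Storm

open CompProblem

variable {n m d l : ℕ} {P : CompProblem n m d l} {Lf Lg Mf Mg H1 H2 H3 : ℝ}

/-- Squared error of the estimate of the inner function. -/
noncomputable def gErr (P : CompProblem n m d l) (s : StormState n m d l) : ℝ :=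
  ‖s.g - P.inner s.x‖ ^ 2

/-- Squared error, in the Frobenius norm, of the estimate of the inner Jacobian. -/
noncomputable def dgErr (P : CompProblem n m d l) (s : StormState n m d l) : ℝ :=
  frobNorm (s.G - fderiv ℝ P.inner s.x) ^ 2

/-- Squared error of `F` as an estimate of `Gᵀ ∇f(g)`, the quantity that its own minibatches
estimate without bias. The bias of `Gᵀ ∇f(g)` itself is measured by `gErr` and `dgErr`. -/
noncomputable def FErr (P : CompProblem n m d l) (s : StormState n m d l) : ℝ :=
  ‖s.F - ContinuousLinearMap.adjoint s.G (gradient P.outer s.g)‖ ^ 2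

theorem gErr_nonneg (s : StormState n m d l) : 0 ≤ gErr P s := sq_nonneg _

theorem dgErr_nonneg (s : StormState n m d l) : 0 ≤ dgErr P s := sq_nonneg _

theorem FErr_nonneg (s : StormState n m d l) : 0 ≤ FErr P s := sq_nonneg _

theorem norm_F_sub_gradient_sq_le (h : P.Regular Lf Lg Mf Mg H1 H2 H3)
    (s : StormState n m d l) :
    ‖s.F - gradient P.Phi s.x‖ ^ 2 ≤
      3 * FErr P s + 3 * Mf ^ 2 * dgErr P s + 3 * Mg ^ 2 * Lf ^ 2 * gErr P s := by
  have hMg := h.Mg_pos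
  have hMf := h.Mf_pos
  have hLf := h.Lf_nonneg
  rw [h.gradient_Phi]
  set A := fderiv ℝ P.inner s.x
  have e : s.F - ContinuousLinearMap.adjoint A (gradient P.outer (P.inner s.x)) =
      (s.F - ContinuousLinearMap.adjoint s.G (gradient P.outer s.g)) +
        ContinuousLinearMap.adjoint (s.G - A) (gradient P.outer s.g) +
        ContinuousLinearMap.adjoint A (gradient P.outer s.g - gradient P.outer (P.inner s.x)) := by
    simp [map_sub]
  have h1 : ‖ContinuousLinearMap.adjoint (s.G - A) (gradient P.outer s.g)‖ ≤
      frobNorm (s.G - A) * Mf := by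
    refine (ContinuousLinearMap.le_opNorm _ _).trans ?_
    rw [LinearIsometryEquiv.norm_map]
    gcongr
    · exact frobNorm_nonneg _
    · exact norm_le_frobNorm _
    · exact h.norm_gradient_outer_le _
  have h2 : ‖ContinuousLinearMap.adjoint A
      (gradient P.outer s.g - gradient P.outer (P.inner s.x))‖ ≤
      Mg * (Lf * ‖s.g - P.inner s.x‖) := by
    refine (ContinuousLinearMap.le_opNorm _ _).trans ?_
    rw [LinearIsometryEquiv.norm_map]
    gcongr
    · exact h.norm_fderiv_inner_le _
    · exact h.norm_gradient_outer_sub_le _ _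
  have h1' := pow_le_pow_left₀ (norm_nonneg _) h1 2
  have h2' := pow_le_pow_left₀ (norm_nonneg _) h2 2
  rw [e]
  refine (norm_add_add_sq_le _ _ _).trans ?_
  simp only [FErr, dgErr, gErr]
  nlinarith

theorem frobCols_dgBatch {B : ℕ} (x : EuclideanSpace ℝ (Fin d)) (b : Fin B → Fin m) :
    frobCols (P.dgBatch x b) = mean fun k => frobCols (fderiv ℝ (P.g (b k)) x) :=
  map_mean _ _

theorem frobCols_stormUpdate (a : ℝ)
    (u p q : EuclideanSpace ℝ (Fin d) →L[ℝ] EuclideanSpace ℝ (Fin l)) :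
    frobCols (stormUpdate a u p q) = stormUpdate a (frobCols u) (frobCols p) (frobCols q) := by
  simp [stormUpdate]

theorem adjoint_dfBatch {B : ℕ} (A : EuclideanSpace ℝ (Fin d) →L[ℝ] EuclideanSpace ℝ (Fin l))
    (y : EuclideanSpace ℝ (Fin l)) (b : Fin B → Fin n) :
    ContinuousLinearMap.adjoint A (P.dfBatch y b) =
      mean fun k => ContinuousLinearMap.adjoint A (gradient (P.f (b k)) y) :=
  map_mean (ContinuousLinearMap.adjoint A).toLinearMap _

section

variable (h : P.Regular Lf Lg Mf Mg H1 H2 H3)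
include h

theorem frobCols_fderiv_inner (x : EuclideanSpace ℝ (Fin d)) :
    frobCols (fderiv ℝ P.inner x) = mean fun j => frobCols (fderiv ℝ (P.g j) x) := by
  rw [h.fderiv_inner]
  exact map_mean _ _

theorem var_frobCols_le (x : EuclideanSpace ℝ (Fin d)) :
    mean (fun j => ‖frobCols (fderiv ℝ (P.g j) x) -
      mean fun j => frobCols (fderiv ℝ (P.g j) x)‖ ^ 2) ≤ H2 := by
  simpa only [← frobCols_fderiv_inner h, ← map_sub, norm_frobCols] using h.var_dg x

theorem adjoint_gradient_outer
    (A : EuclideanSpace ℝ (Fin d) →L[ℝ] EuclideanSpace ℝ (Fin l)) (y : EuclideanSpace ℝ (Fin l)) :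
    ContinuousLinearMap.adjoint A (gradient P.outer y) =
      mean fun i => ContinuousLinearMap.adjoint A (gradient (P.f i) y) := by
  rw [h.gradient_outer]
  exact map_mean (ContinuousLinearMap.adjoint A).toLinearMap _

theorem var_adjoint_le {K : ℝ}
    {A : EuclideanSpace ℝ (Fin d) →L[ℝ] EuclideanSpace ℝ (Fin l)} (hA : ‖A‖ ≤ K)
    (y : EuclideanSpace ℝ (Fin l)) :
    mean (fun i => ‖ContinuousLinearMap.adjoint A (gradient (P.f i) y) -
      mean fun i => ContinuousLinearMap.adjoint A (gradient (P.f i) y)‖ ^ 2) ≤ K ^ 2 * H1 := by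
  have hK : 0 ≤ K := (norm_nonneg A).trans hA
  have h1 : ∀ i, ‖ContinuousLinearMap.adjoint A (gradient (P.f i) y) -
      mean fun i => ContinuousLinearMap.adjoint A (gradient (P.f i) y)‖ ^ 2 ≤
      K ^ 2 * ‖gradient (P.f i) y - gradient P.outer y‖ ^ 2 := fun i => by
    rw [← adjoint_gradient_outer h, ← map_sub, ← mul_pow]
    gcongr
    refine (ContinuousLinearMap.le_opNorm _ _).trans ?_
    rw [LinearIsometryEquiv.norm_map]
    gcongr
  refine (mean_le_mean h1).trans ?_
  rw [mean_mul]
  gcongr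
  exact h.var_f y

theorem norm_dgBatch_le {B : ℕ} (hB : 0 < B) (x : EuclideanSpace ℝ (Fin d))
    (b : Fin B → Fin m) : ‖P.dgBatch x b‖ ≤ Mg := by
  have : Nonempty (Fin B) := ⟨⟨0, hB⟩⟩
  exact norm_mean_le fun k => h.bound_g (b k) x

theorem norm_dgBatch_sub_le {B : ℕ} (hB : 0 < B) (x x' : EuclideanSpace ℝ (Fin d))
    (b : Fin B → Fin m) : ‖P.dgBatch x b - P.dgBatch x' b‖ ≤ Lg * ‖x - x'‖ := by
  have : Nonempty (Fin B) := ⟨⟨0, hB⟩⟩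
  simp only [dgBatch]
  rw [← mean_sub]
  exact norm_mean_le fun k => (norm_le_frobNorm _).trans (h.lip_g (b k) x x')

/-- The initial squared errors are variances of minibatch means. -/
theorem mean_gErr_init_le (p : StormParams) (hSg : 0 < p.Sg)
    (x0 : EuclideanSpace ℝ (Fin d)) :
    mean (fun b => gErr P (init P p x0 b)) ≤ H3 / p.Sg := by
  have := h.nonempty_g
  have := h.nonempty_f
  refine (mean_fst (fun b : Fin p.Sg → Fin m => ‖P.gBatch x0 b - P.inner x0‖ ^ 2)).trans_le ?_
  refine (mean_batch_sub_sq (fun j => P.g j x0) hSg).trans_le ?_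
  gcongr
  exact h.var_g x0

theorem mean_dgErr_init_le (p : StormParams) (hSdg : 0 < p.Sdg)
    (x0 : EuclideanSpace ℝ (Fin d)) :
    mean (fun b => dgErr P (init P p x0 b)) ≤ H2 / p.Sdg := by
  have := h.nonempty_g
  have := h.nonempty_f
  refine (mean_snd (fun b : (Fin p.Sdg → Fin m) × (Fin p.Sf → Fin n) =>
    frobNorm (P.dgBatch x0 b.1 - fderiv ℝ P.inner x0) ^ 2)).trans_le ?_
  refine (mean_fst (fun b : Fin p.Sdg → Fin m =>
    frobNorm (P.dgBatch x0 b - fderiv ℝ P.inner x0) ^ 2)).trans_le ?_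
  simp only [← norm_frobCols, map_sub, frobCols_dgBatch, frobCols_fderiv_inner h]
  refine (mean_batch_sub_sq (fun j => frobCols (fderiv ℝ (P.g j) x0)) hSdg).trans_le ?_
  gcongr
  exact var_frobCols_le h x0

theorem mean_FErr_init_le (p : StormParams) (hSdg : 0 < p.Sdg) (hSf : 0 < p.Sf)
    (x0 : EuclideanSpace ℝ (Fin d)) :
    mean (fun b => FErr P (init P p x0 b)) ≤ Mg ^ 2 * H1 / p.Sf := by
  have := h.nonempty_g
  have := h.nonempty_f
  rw [mean_prod]
  refine mean_le_of_forall_le fun b1 => ?_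
  rw [mean_prod]
  refine mean_le_of_forall_le fun b2 => ?_
  simp only [FErr, init, adjoint_dfBatch, adjoint_gradient_outer h]
  refine (mean_batch_sub_sq (fun i => ContinuousLinearMap.adjoint (P.dgBatch x0 b2)
    (gradient (P.f i) (P.gBatch x0 b1))) hSf).trans_le ?_
  gcongr
  exact var_adjoint_le h (norm_dgBatch_le h hSdg x0 b2) _

variable (p : StormParams) {r : ℝ} (s : StormState n m d l) (hr : ‖nextX p s.x s.F - s.x‖ ≤ r)
include hr

theorem mean_gErr_step_le (ha0 : 0 ≤ p.ag) (ha1 : p.ag ≤ 1) (hB : 0 < p.Bg) :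
    mean (fun b => gErr P (step P p s b)) ≤
      (1 - p.ag) * gErr P s + (2 * p.ag ^ 2 * H3 + 2 * (Mg * r) ^ 2) / p.Bg := by
  have := h.nonempty_g
  have := h.nonempty_f
  have hMg := h.Mg_pos
  refine (mean_fst (fun b : Fin p.Bg → Fin m => ‖stormUpdate p.ag s.g (P.gBatch s.x b)
    (P.gBatch (nextX p s.x s.F) b) - P.inner (nextX p s.x s.F)‖ ^ 2)).trans_le ?_
  refine mean_stormUpdate_error_le s.g (fun j => P.g j s.x)
    (fun j => P.g j (nextX p s.x s.F)) ha0 ha1 (h.var_g _) ?_ hB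
  refine mean_le_of_forall_le fun j => ?_
  gcongr
  exact (h.norm_g_sub_le j _ _).trans (by gcongr)

theorem mean_g_drift_le (hB : 0 < p.Bg) :
    mean (fun b : Fin p.Bg → Fin m => ‖stormUpdate p.ag s.g (P.gBatch s.x b)
        (P.gBatch (nextX p s.x s.F) b) - s.g‖ ^ 2) ≤
      3 * p.ag ^ 2 * gErr P s + 3 * (Mg * r) ^ 2 + 3 * p.ag ^ 2 * H3 / p.Bg := by
  have := h.nonempty_g
  have hMg := h.Mg_pos
  refine mean_stormUpdate_sub_sq_le s.g (fun j => P.g j s.x)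
    (fun j => P.g j (nextX p s.x s.F)) (h.var_g _) (fun j => ?_) hB
  exact (h.norm_g_sub_le j _ _).trans (by gcongr)

theorem mean_dgErr_step_le (ha0 : 0 ≤ p.adg) (ha1 : p.adg ≤ 1) (hB : 0 < p.Bdg) :
    mean (fun b => dgErr P (step P p s b)) ≤
      (1 - p.adg) * dgErr P s + (2 * p.adg ^ 2 * H2 + 2 * (Lg * r) ^ 2) / p.Bdg := by
  have := h.nonempty_g
  have := h.nonempty_f
  have hLg := h.Lg_nonneg
  refine (mean_snd (fun b : (Fin p.Bdg → Fin m) × (Fin p.Bf → Fin n) =>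
    frobNorm (stormUpdate p.adg s.G (P.dgBatch s.x b.1)
      (P.dgBatch (nextX p s.x s.F) b.1) - fderiv ℝ P.inner (nextX p s.x s.F)) ^ 2)).trans_le ?_
  refine (mean_fst (fun b : Fin p.Bdg → Fin m =>
    frobNorm (stormUpdate p.adg s.G (P.dgBatch s.x b)
      (P.dgBatch (nextX p s.x s.F) b) - fderiv ℝ P.inner (nextX p s.x s.F)) ^ 2)).trans_le ?_
  simp only [dgErr, ← norm_frobCols, map_sub, frobCols_stormUpdate, frobCols_dgBatch,
    frobCols_fderiv_inner h]
  refine mean_stormUpdate_error_le (frobCols s.G) (fun j => frobCols (fderiv ℝ (P.g j) s.x))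
    (fun j => frobCols (fderiv ℝ (P.g j) (nextX p s.x s.F))) ha0 ha1 (var_frobCols_le h _) ?_ hB
  refine mean_le_of_forall_le fun j => ?_
  rw [← map_sub, norm_frobCols]
  gcongr
  · exact frobNorm_nonneg _
  · exact (h.lip_g j _ _).trans (by gcongr)

theorem mean_dg_drift_le (hB : 0 < p.Bdg) :
    mean (fun b : Fin p.Bdg → Fin m => frobNorm (stormUpdate p.adg s.G (P.dgBatch s.x b)
        (P.dgBatch (nextX p s.x s.F) b) - s.G) ^ 2) ≤
      3 * p.adg ^ 2 * dgErr P s + 3 * (Lg * r) ^ 2 + 3 * p.adg ^ 2 * H2 / p.Bdg := by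
  have := h.nonempty_g
  have hLg := h.Lg_nonneg
  simp only [dgErr, ← norm_frobCols, map_sub, frobCols_stormUpdate, frobCols_dgBatch,
    frobCols_fderiv_inner h]
  refine mean_stormUpdate_sub_sq_le (frobCols s.G) (fun j => frobCols (fderiv ℝ (P.g j) s.x))
    (fun j => frobCols (fderiv ℝ (P.g j) (nextX p s.x s.F))) (var_frobCols_le h _) (fun j => ?_) hB
  rw [← map_sub, norm_frobCols]
  exact (h.lip_g j _ _).trans (by gcongr)

/-- The Jacobian estimates stay in a fixed ball: the pull of weight `adg` towards Jacobians of
norm at most `Mg` balances increments of size `Lg * r`. -/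
theorem norm_G_step_le {K : ℝ} (ha0 : 0 < p.adg) (ha1 : p.adg ≤ 1) (hB : 0 < p.Bdg)
    (hK : Mg + Lg * r / p.adg ≤ K) (hG : ‖s.G‖ ≤ K) (b : StepBatch n m p) :
    ‖(step P p s b).G‖ ≤ K := by
  have hLg := h.Lg_nonneg
  have h1 := norm_dgBatch_le h hB (nextX p s.x s.F) b.2.1
  have h2 : ‖P.dgBatch (nextX p s.x s.F) b.2.1 - P.dgBatch s.x b.2.1‖ ≤ Lg * r :=
    (norm_dgBatch_sub_le h hB (nextX p s.x s.F) s.x b.2.1).trans (by gcongr)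
  have h3 : p.adg * Mg + Lg * r ≤ p.adg * K := by
    have := mul_le_mul_of_nonneg_left hK ha0.le
    rwa [mul_add, mul_div_cancel₀ _ ha0.ne'] at this
  have h4 : 0 ≤ Lg * r := (norm_nonneg _).trans h2
  have h5 : 0 ≤ 1 - p.adg := by linarith
  calc ‖(step P p s b).G‖
      ≤ (1 - p.adg) * K + p.adg * Mg + (1 - p.adg) * (Lg * r) := by
        refine norm_add₃_le.trans ?_
        simp only [norm_smul, Real.norm_eq_abs, abs_of_nonneg h5, abs_of_pos ha0]
        gcongr
    _ ≤ K := by nlinarith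

theorem mean_FErr_step_le {K : ℝ} (ha0 : 0 ≤ p.aPhi) (ha1 : p.aPhi ≤ 1)
    (hBg : 0 < p.Bg) (hBdg : 0 < p.Bdg) (hBf : 0 < p.Bf) (hG : ‖s.G‖ ≤ K)
    (hG' : ∀ b, ‖(step P p s b).G‖ ≤ K) :
    mean (fun b => FErr P (step P p s b)) ≤
      (1 - p.aPhi) * FErr P s + (2 * p.aPhi ^ 2 * (K ^ 2 * H1) +
        (4 * Mf ^ 2 *
            (3 * p.adg ^ 2 * dgErr P s + 3 * (Lg * r) ^ 2 + 3 * p.adg ^ 2 * H2 / p.Bdg) +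
          4 * K ^ 2 * Lf ^ 2 *
            (3 * p.ag ^ 2 * gErr P s + 3 * (Mg * r) ^ 2 + 3 * p.ag ^ 2 * H3 / p.Bg))) / p.Bf := by
  have := h.nonempty_g
  have := h.nonempty_f
  have hMf := h.Mf_pos
  have hLf := h.Lf_nonneg
  have hK : 0 ≤ K := (norm_nonneg _).trans hG
  set g' : (Fin p.Bg → Fin m) → EuclideanSpace ℝ (Fin l) := fun b =>
    stormUpdate p.ag s.g (P.gBatch s.x b) (P.gBatch (nextX p s.x s.F) b) with hg'
  set G' : (Fin p.Bdg → Fin m) → EuclideanSpace ℝ (Fin d) →L[ℝ] EuclideanSpace ℝ (Fin l) :=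
    fun b => stormUpdate p.adg s.G (P.dgBatch s.x b) (P.dgBatch (nextX p s.x s.F) b) with hGdef
  -- For fixed inner minibatches, the outer one is that of a STORM estimate of `G'ᵀ ∇f(g')`.
  have hcond : ∀ b1 b2, mean (fun b3 => FErr P (step P p s (b1, b2, b3))) ≤
      ((1 - p.aPhi) * FErr P s + 2 * p.aPhi ^ 2 * (K ^ 2 * H1) / p.Bf) +
        4 * Mf ^ 2 / p.Bf * frobNorm (G' b2 - s.G) ^ 2 +
        4 * K ^ 2 * Lf ^ 2 / p.Bf * ‖g' b1 - s.g‖ ^ 2 := by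
    intro b1 b2
    have hGb : ‖G' b2‖ ≤ K := hG' (b1, b2, fun _ => Classical.arbitrary _)
    have hD : mean (fun i => ‖ContinuousLinearMap.adjoint (G' b2) (gradient (P.f i) (g' b1)) -
        ContinuousLinearMap.adjoint s.G (gradient (P.f i) s.g)‖ ^ 2) ≤
        2 * Mf ^ 2 * frobNorm (G' b2 - s.G) ^ 2 + 2 * K ^ 2 * Lf ^ 2 * ‖g' b1 - s.g‖ ^ 2 := by
      refine mean_le_of_forall_le fun i => ?_
      have h1 : ‖ContinuousLinearMap.adjoint (G' b2) (gradient (P.f i) (g' b1)) -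
          ContinuousLinearMap.adjoint s.G (gradient (P.f i) s.g)‖ ≤
          frobNorm (G' b2 - s.G) * Mf + K * (Lf * ‖g' b1 - s.g‖) := by
        refine (Regular.norm_adjoint_sub_le _ _ _ _).trans ?_
        gcongr
        · exact frobNorm_nonneg _
        · exact norm_le_frobNorm _
        · exact h.bound_f i _
        · exact h.lip_f i _ _
      have h2 := pow_le_pow_left₀ (norm_nonneg _) h1 2
      nlinarith [sq_nonneg (frobNorm (G' b2 - s.G) * Mf - K * (Lf * ‖g' b1 - s.g‖))]
    have key := mean_stormUpdate_error_le s.F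
      (fun i => ContinuousLinearMap.adjoint s.G (gradient (P.f i) s.g))
      (fun i => ContinuousLinearMap.adjoint (G' b2) (gradient (P.f i) (g' b1)))
      ha0 ha1 (var_adjoint_le h hGb (g' b1)) hD hBf
    simp only [← adjoint_dfBatch, ← adjoint_gradient_outer h] at key
    refine key.trans_eq ?_
    simp only [FErr]
    ring
  have hdg : mean (fun b => frobNorm (G' b - s.G) ^ 2) ≤ _ := mean_dg_drift_le h p s hr hBdg
  have hg : mean (fun b => ‖g' b - s.g‖ ^ 2) ≤ _ := mean_g_drift_le h p s hr hBg
  calc mean (fun b => FErr P (step P p s b))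
      = mean fun b1 => mean fun b2 => mean fun b3 => FErr P (step P p s (b1, b2, b3)) := by
        rw [mean_prod]
        simp only [mean_prod]
    _ ≤ _ := mean_le_mean fun b1 => mean_le_mean fun b2 => hcond b1 b2
    _ = ((1 - p.aPhi) * FErr P s + 2 * p.aPhi ^ 2 * (K ^ 2 * H1) / p.Bf) +
        4 * Mf ^ 2 / p.Bf * mean (fun b => frobNorm (G' b - s.G) ^ 2) +
        4 * K ^ 2 * Lf ^ 2 / p.Bf * mean (fun b => ‖g' b - s.g‖ ^ 2) := by
        simp only [mean_add, mean_mul, mean_const]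
    _ ≤ _ := by
        have e1 := mul_le_mul_of_nonneg_left hdg (by positivity : 0 ≤ 4 * Mf ^ 2 / (p.Bf : ℝ))
        have e2 := mul_le_mul_of_nonneg_left hg
          (by positivity : 0 ≤ 4 * K ^ 2 * Lf ^ 2 / (p.Bf : ℝ))
        refine (add_le_add (add_le_add le_rfl e1) e2).trans_eq ?_
        ring

end

end Storm

/-! ### Averaging over the draws of a run -/

namespace Storm

open CompProblem

variable {n m d l : ℕ} {P : CompProblem n m d l} {p : StormParams}
  {x0 : EuclideanSpace ℝ (Fin d)}

theorem state_succ {t : ℕ} (ht : t < p.T) (ω : StormDraws n m p) :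
    state P p x0 ω (t + 1) = step P p (state P p x0 ω t) (ω.2.1 ⟨t, ht⟩) := by
  simp [state, ht]

/-- The state after `t` iterations depends on the draws made up to then only. -/
theorem state_congr {ω ω' : StormDraws n m p} (h0 : ω.1 = ω'.1) {t : ℕ}
    (h : ∀ k : Fin p.T, k.val < t → ω.2.1 k = ω'.2.1 k) :
    state P p x0 ω t = state P p x0 ω' t := by
  induction t with
  | zero => simp [state, h0]
  | succ t ih =>
    have ih' := ih fun k hk => h k (by omega)
    by_cases ht : t < p.T
    · rw [state_succ ht, state_succ ht, ih', h ⟨t, ht⟩ (Nat.lt_succ_self t)]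
    · simp [state, ht, ih']

theorem mean_state_zero [Nonempty (Fin m)] [Nonempty (Fin n)] (hT : 0 < p.T)
    (φ : StormState n m d l → ℝ) :
    mean (fun ω : StormDraws n m p => φ (state P p x0 ω 0)) =
      mean fun b => φ (init P p x0 b) := by
  have : Nonempty (Fin p.T) := ⟨⟨0, hT⟩⟩
  exact mean_fst fun b => φ (init P p x0 b)

/-- The minibatches of an iteration are independent of the state that it starts from. -/
theorem mean_state_succ [Nonempty (Fin m)] [Nonempty (Fin n)] {t : ℕ} (ht : t < p.T)
    (φ : StormState n m d l → ℝ) :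
    mean (fun ω : StormDraws n m p => φ (state P p x0 ω (t + 1))) =
      mean fun ω : StormDraws n m p => mean fun b => φ (step P p (state P p x0 ω t) b) := by
  have : Nonempty (Fin p.T) := ⟨⟨t, ht⟩⟩
  simp only [state_succ ht]
  refine mean_coord (fun ω : StormDraws n m p => ω.2.1 ⟨t, ht⟩)
    (fun ω b => (ω.1, Function.update ω.2.1 ⟨t, ht⟩ b, ω.2.2)) ?_ ?_
    (fun ω b => φ (step P p (state P p x0 ω t) b)) ?_
  · intro ω b
    simp
  · intro ω b
    simp
  · intro ω b c
    congr 2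
    refine state_congr ?_ fun k hk => ?_
    · rfl
    have hne : k ≠ ⟨t, ht⟩ := fun e => by simp [e] at hk
    simp [hne]

theorem mean_output [Nonempty (Fin m)] [Nonempty (Fin n)] (hT : 0 < p.T)
    (φ : EuclideanSpace ℝ (Fin d) → ℝ) :
    mean (fun ω : StormDraws n m p => φ (output P p x0 ω)) =
      mean fun ω : StormDraws n m p =>
        (p.T : ℝ)⁻¹ * ∑ t ∈ Finset.range p.T, φ (state P p x0 ω (t + 1)).x := by
  have : Nonempty (Fin p.T) := ⟨⟨0, hT⟩⟩
  refine (mean_coord (fun ω : StormDraws n m p => ω.2.2) (fun ω k => (ω.1, ω.2.1, k))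
    (fun _ _ => rfl) (fun _ _ => rfl) (fun ω k => φ (state P p x0 ω (k.val + 1)).x) ?_).trans ?_
  · intro ω b c
    congr 2
    apply state_congr
    · rfl
    · exact fun k _ => rfl
  · simp [mean, Finset.sum_range]

theorem length_log_state (ω : StormDraws n m p) {t : ℕ} (ht : t ≤ p.T) :
    (state P p x0 ω t).log.length =
      p.Sg + p.Sdg + p.Sf + t * (p.Bg + p.Bdg + p.Bf) := by
  induction t with
  | zero => simp [state, init, requests, add_assoc]
  | succ t ih =>
    rw [state_succ (by omega)]
    simp only [step, requests, List.length_append, List.length_ofFn, ih (by omega)]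
    ring

/-! ### Accumulated errors of the estimates -/

/-- The quantity `∑ E φ(state t)`, summed over the states in which an iteration starts. -/
noncomputable def accum (P : CompProblem n m d l) (p : StormParams)
    (x0 : EuclideanSpace ℝ (Fin d)) (φ : StormState n m d l → ℝ) : ℝ :=
  ∑ t ∈ Finset.range p.T, mean fun ω : StormDraws n m p => φ (state P p x0 ω t)

variable {Lf Lg Mf Mg H1 H2 H3 : ℝ}

section

variable (h : P.Regular Lf Lg Mf Mg H1 H2 H3) {r : ℝ}
  (hr : ∀ x F : EuclideanSpace ℝ (Fin d), ‖nextX p x F - x‖ ≤ r)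
include h hr

theorem norm_G_state_le {K : ℝ} (ha0 : 0 < p.adg) (ha1 : p.adg ≤ 1) (hB : 0 < p.Bdg)
    (hS : 0 < p.Sdg) (hK : Mg + Lg * r / p.adg ≤ K) (ω : StormDraws n m p) (t : ℕ) :
    ‖(state P p x0 ω t).G‖ ≤ K := by
  induction t with
  | zero =>
    have hr0 : 0 ≤ r := (norm_nonneg _).trans (hr 0 0)
    have := mul_nonneg h.Lg_nonneg hr0
    exact (norm_dgBatch_le h hS x0 ω.1.2.1).trans (le_trans (by simp; positivity) hK)
  | succ t ih =>
    by_cases ht : t < p.T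
    · rw [state_succ ht]
      exact norm_G_step_le h p _ (hr _ _) ha0 ha1 hB hK ih _
    · simpa [state, ht] using ih

variable (hT : 0 < p.T)
include hT

theorem accum_gErr_le (ha0 : 0 ≤ p.ag) (ha1 : p.ag ≤ 1) (hB : 0 < p.Bg) (hS : 0 < p.Sg) :
    p.ag * accum P p x0 (gErr P) ≤
      H3 / p.Sg + p.T * ((2 * p.ag ^ 2 * H3 + 2 * (Mg * r) ^ 2) / p.Bg) := by
  have := h.nonempty_g
  have := h.nonempty_f
  have : Nonempty (Fin p.T) := ⟨⟨0, hT⟩⟩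
  refine (mul_sum_le_of_contraction (c := fun _ => (2 * p.ag ^ 2 * H3 + 2 * (Mg * r) ^ 2) / p.Bg)
    (fun t => mean_nonneg fun ω => gErr_nonneg _) fun t ht => ?_).trans ?_
  · rw [mean_state_succ ht]
    refine (mean_le_mean fun ω =>
      mean_gErr_step_le h p (state P p x0 ω t) (hr _ _) ha0 ha1 hB).trans_eq ?_
    rw [mean_add, mean_mul, mean_const]
  · rw [Finset.sum_const, Finset.card_range, nsmul_eq_mul, mean_state_zero hT]
    gcongr
    exact mean_gErr_init_le h p hS x0

theorem accum_dgErr_le (ha0 : 0 ≤ p.adg) (ha1 : p.adg ≤ 1) (hB : 0 < p.Bdg) (hS : 0 < p.Sdg) :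
    p.adg * accum P p x0 (dgErr P) ≤
      H2 / p.Sdg + p.T * ((2 * p.adg ^ 2 * H2 + 2 * (Lg * r) ^ 2) / p.Bdg) := by
  have := h.nonempty_g
  have := h.nonempty_f
  have : Nonempty (Fin p.T) := ⟨⟨0, hT⟩⟩
  refine (mul_sum_le_of_contraction
    (c := fun _ => (2 * p.adg ^ 2 * H2 + 2 * (Lg * r) ^ 2) / p.Bdg)
    (fun t => mean_nonneg fun ω => dgErr_nonneg _) fun t ht => ?_).trans ?_
  · rw [mean_state_succ ht]
    refine (mean_le_mean fun ω =>
      mean_dgErr_step_le h p (state P p x0 ω t) (hr _ _) ha0 ha1 hB).trans_eq ?_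
    rw [mean_add, mean_mul, mean_const]
  · rw [Finset.sum_const, Finset.card_range, nsmul_eq_mul, mean_state_zero hT]
    gcongr
    exact mean_dgErr_init_le h p hS x0

theorem accum_FErr_le {K : ℝ} (hdg0 : 0 < p.adg) (hdg1 : p.adg ≤ 1)
    (ha0 : 0 ≤ p.aPhi) (ha1 : p.aPhi ≤ 1) (hBg : 0 < p.Bg) (hBdg : 0 < p.Bdg) (hBf : 0 < p.Bf)
    (hSdg : 0 < p.Sdg) (hSf : 0 < p.Sf) (hK : Mg + Lg * r / p.adg ≤ K) :
    p.aPhi * accum P p x0 (FErr P) ≤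
      Mg ^ 2 * H1 / p.Sf + (p.T * (2 * p.aPhi ^ 2 * (K ^ 2 * H1)) +
        (4 * Mf ^ 2 * (3 * p.adg ^ 2 * accum P p x0 (dgErr P) +
            p.T * (3 * (Lg * r) ^ 2 + 3 * p.adg ^ 2 * H2 / p.Bdg)) +
          4 * K ^ 2 * Lf ^ 2 * (3 * p.ag ^ 2 * accum P p x0 (gErr P) +
            p.T * (3 * (Mg * r) ^ 2 + 3 * p.ag ^ 2 * H3 / p.Bg)))) / p.Bf := by
  have := h.nonempty_g
  have := h.nonempty_f
  have : Nonempty (Fin p.T) := ⟨⟨0, hT⟩⟩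
  have hG : ∀ (ω : StormDraws n m p) t, ‖(state P p x0 ω t).G‖ ≤ K :=
    norm_G_state_le h hr hdg0 hdg1 hBdg hSdg hK
  refine (mul_sum_le_of_contraction (c := fun t => (2 * p.aPhi ^ 2 * (K ^ 2 * H1) +
        (4 * Mf ^ 2 * (3 * p.adg ^ 2 * mean (fun ω : StormDraws n m p =>
            dgErr P (state P p x0 ω t)) + (3 * (Lg * r) ^ 2 + 3 * p.adg ^ 2 * H2 / p.Bdg)) +
          4 * K ^ 2 * Lf ^ 2 * (3 * p.ag ^ 2 * mean (fun ω : StormDraws n m p =>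
            gErr P (state P p x0 ω t)) + (3 * (Mg * r) ^ 2 + 3 * p.ag ^ 2 * H3 / p.Bg)))) / p.Bf)
    (fun t => mean_nonneg fun ω => FErr_nonneg _) fun t ht => ?_).trans ?_
  · rw [mean_state_succ ht]
    refine (mean_le_mean fun ω =>
      mean_FErr_step_le h p (state P p x0 ω t) (hr _ _) ha0 ha1 hBg hBdg hBf (hG ω t) fun b =>
        norm_G_step_le h p _ (hr _ _) hdg0 hdg1 hBdg hK (hG ω t) b).trans_eq ?_
    simp only [div_eq_inv_mul (b := (p.Bf : ℝ)), mean_add, mean_mul, mean_const]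
    ring
  · rw [mean_state_zero hT]
    refine add_le_add (mean_FErr_init_le h p hSdg hSf x0) (le_of_eq ?_)
    rw [← Finset.sum_div]
    simp only [Finset.sum_add_distrib, ← Finset.mul_sum, Finset.sum_const, Finset.card_range,
      nsmul_eq_mul, accum]
    ring

end

/-- Reduction of the expected gradient norm at the output to the accumulated squared errors. -/
theorem mean_norm_gradient_output_le (h : P.Regular Lf Lg Mf Mg H1 H2 H3) (hT : 0 < p.T)
    (hL0 : 0 < Mf * Lg + Mg ^ 2 * Lf) (hη : p.eta = 1 / (Mf * Lg + Mg ^ 2 * Lf))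
    (hε : 0 < p.eps) (hbdd : BddBelow (Set.range P.Phi)) :
    p.T * p.eps *
        mean (fun ω : StormDraws n m p => ‖gradient P.Phi (output P p x0 ω)‖) ≤
      p.T * (p.eps ^ 2 / 2) +
        2 * (Mf * Lg + Mg ^ 2 * Lf) * (P.Phi x0 - ⨅ x, P.Phi x) +
        3 / 2 * (3 * accum P p x0 (FErr P) + 3 * Mf ^ 2 * accum P p x0 (dgErr P) +
          3 * Mg ^ 2 * Lf ^ 2 * accum P p x0 (gErr P)) := by
  have := h.nonempty_g
  have := h.nonempty_f
  have : Nonempty (Fin p.T) := ⟨⟨0, hT⟩⟩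
  have hTR : (p.T : ℝ) ≠ 0 := by positivity
  rw [mean_output hT fun x => ‖gradient P.Phi x‖, ← mean_mul]
  simp only [accum, Finset.mul_sum, ← mean_finset_sum, ← mean_mul, ← mean_add,
    ← Finset.sum_add_distrib]
  have hpath : ∀ ω : StormDraws n m p,
      p.T * p.eps * ∑ t ∈ Finset.range p.T,
          (p.T : ℝ)⁻¹ * ‖gradient P.Phi (state P p x0 ω (t + 1)).x‖ ≤
        (p.T * (p.eps ^ 2 / 2) + 2 * (Mf * Lg + Mg ^ 2 * Lf) * (P.Phi x0 - ⨅ x, P.Phi x)) +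
          ∑ t ∈ Finset.range p.T, 3 / 2 * (3 * FErr P (state P p x0 ω t) +
            3 * Mf ^ 2 * dgErr P (state P p x0 ω t) +
            3 * Mg ^ 2 * Lf ^ 2 * gErr P (state P p x0 ω t)) := fun ω => by
    have key := sum_norm_gradient_le h.differentiable_Phi hL0 h.norm_gradient_Phi_sub_le hbdd p hη
      hε (fun t => (state P p x0 ω t).x) (fun t => (state P p x0 ω t).F) hT fun t ht => by
        rw [state_succ ht]
        rfl
    rw [← Finset.mul_sum, ← Finset.mul_sum]
    have e : ∀ S : ℝ, p.T * p.eps * ((p.T : ℝ)⁻¹ * S) = p.eps * S := fun S => by field_simp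
    rw [e]
    refine key.trans ?_
    have hx : (state P p x0 ω 0).x = x0 := rfl
    rw [hx]
    gcongr with t ht
    exact norm_F_sub_gradient_sq_le h _
  have hmean := mean_le_mean hpath
  rw [mean_add, mean_const] at hmean
  simpa only [Finset.mul_sum, ← mean_finset_sum, ← mean_mul, ← mean_add,
    ← Finset.sum_add_distrib] using hmean

end Storm

/-! ### The choice of the parameters -/

section Parameters

/-- The accumulated error of an inner estimate, with `T = τ / ε²`, in terms of the parameters. -/
theorem accum_bound_of_params {U V M L τ ε α β γ : ℝ} (hL : 0 < L) (hτ : 0 < τ) (hε : 0 < ε)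
    (hα : 0 < α) (hβ : 0 < β) (hγ : 0 < γ)
    (h : α * ε * U ≤ V / (γ * ε⁻¹) + τ * (ε ^ 2)⁻¹ *
      ((2 * (α * ε) ^ 2 * V + 2 * (M * (ε / L)) ^ 2) / (β * ε⁻¹))) :
    U ≤ τ * (V / (τ * α * γ) + 2 * α * V / β + 2 * M ^ 2 / (L ^ 2 * α * β)) := by
  refine le_of_mul_le_mul_left (h.trans_eq ?_) (mul_pos hα hε)
  field_simp
  ring

/-- The accumulated drift of an inner estimate. Here `α * ε ≤ 1` absorbs the factor `(α * ε)²` of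
the accumulated error. -/
theorem drift_bound_of_params {U V M L τ ε α β γ : ℝ} (hL : 0 < L) (hτ : 0 < τ) (hε : 0 < ε)
    (hα : 0 < α) (hβ : 0 < β) (hγ : 0 < γ) (hV : 0 < V) (hα1 : α * ε < 1)
    (hU : U ≤ τ * (V / (τ * α * γ) + 2 * α * V / β + 2 * M ^ 2 / (L ^ 2 * α * β))) :
    3 * (α * ε) ^ 2 * U + τ * (ε ^ 2)⁻¹ *
        (3 * (M * (ε / L)) ^ 2 + 3 * (α * ε) ^ 2 * V / (β * ε⁻¹)) ≤
      τ * (3 * M ^ 2 / L ^ 2 * (4 / (α * β) + 2 * ε / β + 1) + 12 * V / (τ * α * γ) +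
        6 * α * V / β * (2 + α * ε)) := by
  set q := V / (τ * α * γ) + 2 * α * V / β + 2 * M ^ 2 / (L ^ 2 * α * β) with hq
  have hq0 : 0 ≤ q := by positivity
  have h1 : (α * ε) ^ 2 ≤ 1 := pow_le_one₀ (by positivity) hα1.le
  have h2 : 3 * (α * ε) ^ 2 * U ≤ 3 * (τ * q) := by
    calc 3 * (α * ε) ^ 2 * U ≤ 3 * (α * ε) ^ 2 * (τ * q) := by gcongr
      _ ≤ 3 * 1 * (τ * q) := by gcongr
      _ = 3 * (τ * q) := by ring
  have h3 : τ * (ε ^ 2)⁻¹ * (3 * (M * (ε / L)) ^ 2 + 3 * (α * ε) ^ 2 * V / (β * ε⁻¹)) =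
      τ * (3 * M ^ 2 / L ^ 2 + 3 * α * V / β * (α * ε)) := by
    field_simp
  have h4 : 0 ≤ τ * (6 * M ^ 2 / (L ^ 2 * α * β) + 6 * M ^ 2 / L ^ 2 * ε / β +
      9 * V / (τ * α * γ) + 6 * α * V / β + 3 * α * V / β * (α * ε)) := by positivity
  rw [h3]
  have h5 : τ * (3 * M ^ 2 / L ^ 2 * (4 / (α * β) + 2 * ε / β + 1) + 12 * V / (τ * α * γ) +
        6 * α * V / β * (2 + α * ε)) =
      3 * (τ * q) + τ * (3 * M ^ 2 / L ^ 2 + 3 * α * V / β * (α * ε)) +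
      τ * (6 * M ^ 2 / (L ^ 2 * α * β) + 6 * M ^ 2 / L ^ 2 * ε / β +
      9 * V / (τ * α * γ) + 6 * α * V / β + 3 * α * V / β * (α * ε)) := by
    rw [hq]
    field_simp
    ring
  linarith

/-- The accumulated error of the gradient estimate, in terms of the accumulated drifts `τ * WG`
and `τ * Wg` of the inner estimates. -/
theorem accum_outer_bound_of_params {U V0 V Mf Lf K τ ε α β γ DG Dg WG Wg : ℝ} (hτ : 0 < τ)
    (hε : 0 < ε) (hα : 0 < α) (hβ : 0 < β) (hγ : 0 < γ) (hDG : DG ≤ τ * WG) (hDg : Dg ≤ τ * Wg)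
    (h : α * ε * U ≤ V0 / (γ * ε⁻¹) + (τ * (ε ^ 2)⁻¹ * (2 * (α * ε) ^ 2 * V) +
      (4 * Mf ^ 2 * DG + 4 * K ^ 2 * Lf ^ 2 * Dg)) / (β * ε⁻¹)) :
    U ≤ τ * (V0 / (τ * α * γ) + 2 * α / β * V + 4 * Mf ^ 2 / (α * β) * WG +
      4 * K ^ 2 * Lf ^ 2 / (α * β) * Wg) := by
  refine le_of_mul_le_mul_left (h.trans ?_) (mul_pos hα hε)
  calc _ ≤ V0 / (γ * ε⁻¹) + (τ * (ε ^ 2)⁻¹ * (2 * (α * ε) ^ 2 * V) +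
      (4 * Mf ^ 2 * (τ * WG) + 4 * K ^ 2 * Lf ^ 2 * (τ * Wg))) / (β * ε⁻¹) := by gcongr
    _ = _ := by
      field_simp
      ring

end Parameters

/-! ### Accuracy and oracle cost of the algorithm -/

theorem theorem1 {n m d l : ℕ} (hn : 0 < n) (hm : 0 < m)
    (P : CompProblem n m d l) (p : StormParams) (x0 : EuclideanSpace ℝ (Fin d))
    (Lf Lg LΦ Mf Mg H1 H2 H3 Δ : ℝ)
    -- differentiability of the component functions
    (hf : ∀ i, Differentiable ℝ (P.f i)) (hg : ∀ j, Differentiable ℝ (P.g j))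
    -- finite gap
    (hbdd : BddBelow (Set.range P.Phi)) (hΔ : Δ = P.Phi x0 - ⨅ x, P.Phi x) (hΔ0 : 0 < Δ)
    -- smoothness
    (hLf0 : 0 ≤ Lf) (hLg0 : 0 ≤ Lg)
    (hLg : ∀ j x x',
      frobNorm (fderiv ℝ (P.g j) x - fderiv ℝ (P.g j) x') ≤ Lg * ‖x - x'‖)
    (hLf : ∀ i y y', ‖gradient (P.f i) y - gradient (P.f i) y'‖ ≤ Lf * ‖y - y'‖)
    -- boundedness
    (hMf0 : 0 < Mf) (hMg0 : 0 < Mg)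
    (hMg : ∀ j x, ‖fderiv ℝ (P.g j) x‖ ≤ Mg)
    (hMf : ∀ i y, ‖gradient (P.f i) y‖ ≤ Mf)
    (hLΦ : LΦ = Mf * Lg + Mg ^ 2 * Lf) (hLΦ0 : 0 < LΦ)
    -- bounded variance, for uniformly random component indices
    (hH10 : 0 < H1) (hH20 : 0 < H2) (hH30 : 0 < H3)
    (hH1 : ∀ y, mean (fun i => ‖gradient (P.f i) y - gradient P.outer y‖ ^ 2) ≤ H1)
    (hH2 : ∀ x, mean (fun j => frobNorm (fderiv ℝ (P.g j) x - fderiv ℝ P.inner x) ^ 2) ≤ H2)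
    (hH3 : ∀ x, mean (fun j => ‖P.g j x - P.inner x‖ ^ 2) ≤ H3)
    -- choice of the parameters
    (ε αg αdg αΦ βg βdg βf γg γdg γf : ℝ) (hε : 0 < ε)
    (hαg : 0 < αg) (hαdg : 0 < αdg) (hαΦ : 0 < αΦ)
    (hβg : 0 < βg) (hβdg : 0 < βdg) (hβf : 0 < βf)
    (hγg : 0 < γg) (hγdg : 0 < γdg) (hγf : 0 < γf)
    (hag1 : αg * ε < 1) (hadg1 : αdg * ε < 1) (haΦ1 : αΦ * ε < 1)
    (hpeps : p.eps = ε) (hpeta : p.eta = 1 / LΦ)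
    (hpag : p.ag = αg * ε) (hpadg : p.adg = αdg * ε) (hpaΦ : p.aPhi = αΦ * ε)
    (hBg : (p.Bg : ℝ) = βg * ε⁻¹) (hBdg : (p.Bdg : ℝ) = βdg * ε⁻¹)
    (hBf : (p.Bf : ℝ) = βf * ε⁻¹)
    (hSg : (p.Sg : ℝ) = γg * ε⁻¹) (hSdg : (p.Sdg : ℝ) = γdg * ε⁻¹)
    (hSf : (p.Sf : ℝ) = γf * ε⁻¹)
    (hT : (p.T : ℝ) = 32 / 3 * LΦ * Δ * (ε ^ 2)⁻¹)
    -- the accuracy condition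
    (K : ℝ) (hK : K = 2 * Mg + Lg / (LΦ * αdg))
    (hcond :
      (36 * Mf ^ 2 * Lg ^ 2 / (αΦ * βf) * (4 / (αdg * βdg) + 2 * ε / βdg + 1)
        + 36 * Lf ^ 2 * Mg ^ 2 / (αΦ * βf) * K ^ 2 * (4 / (αg * βg) + 2 * ε / βg + 1)
        + 6 * Mf ^ 2 * Lg ^ 2 / (αdg * βdg) + 6 * Mg ^ 4 * Lf ^ 2 / (αg * βg)) * (1 / LΦ ^ 2)
      + 6 * Mf ^ 2 * H2 / (32 / 3 * LΦ * Δ * αdg * γdg) * (24 / (αΦ * βf) + 1)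
      + 6 * Lf ^ 2 * H3 / (32 / 3 * LΦ * Δ * αg * γg) * (24 / (αΦ * βf) * K ^ 2 + Mg ^ 2)
      + 3 * Mg ^ 2 * H1 / (32 / 3 * LΦ * Δ * αΦ * γf)
      + 72 * Mf ^ 2 * αdg * H2 / (αΦ * βf * βdg) * (2 + αdg * ε)
      + 72 * Lf ^ 2 * αg * H3 / (αΦ * βf * βg) * K ^ 2 * (2 + αg * ε)
      + 6 * αΦ / βf * K ^ 2 * H1
      + 6 * Mf ^ 2 * αdg * H2 / βdg
      + 6 * Mg ^ 2 * Lf ^ 2 * αg * H3 / βg ≤ 1 / 16) :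
    mean (fun ω : StormDraws n m p => ‖gradient P.Phi (Storm.output P p x0 ω)‖) ≤ ε ∧
    ∀ ω : StormDraws n m p,
      (Storm.ifo P p x0 ω : ℝ) =
        (γg + γdg + γf) * ε⁻¹ + 32 / 3 * LΦ * Δ * (βg + βdg + βf) * (ε ^ 3)⁻¹ := by
  have hreg : P.Regular Lf Lg Mf Mg H1 H2 H3 :=
    ⟨hn, hm, hf, hg, hLf0, hLg0, hMf0, hMg0, hLg, hLf, hMg, hMf, hH1, hH2, hH3⟩
  have cast_pos : ∀ {N : ℕ} {c : ℝ}, 0 < c → (N : ℝ) = c * ε⁻¹ → 0 < N := fun hc h => by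
    rw [← Nat.cast_pos (α := ℝ), h]
    positivity
  have hBg0 := cast_pos hβg hBg
  have hBdg0 := cast_pos hβdg hBdg
  have hBf0 := cast_pos hβf hBf
  have hSg0 := cast_pos hγg hSg
  have hSdg0 := cast_pos hγdg hSdg
  have hSf0 := cast_pos hγf hSf
  set τ := 32 / 3 * LΦ * Δ with hτ
  have hτ0 : 0 < τ := by positivity
  have hT0 : 0 < p.T := by
    rw [← Nat.cast_pos (α := ℝ), hT]
    positivity
  constructor
  · have hr : ∀ x F : EuclideanSpace ℝ (Fin d), ‖Storm.nextX p x F - x‖ ≤ ε / LΦ := fun x F => by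
      have := Storm.norm_nextX_sub_le p hLΦ0 hpeta (hpeps ▸ hε) x F
      rwa [hpeps] at this
    have hag0 : 0 < p.ag := hpag ▸ mul_pos hαg hε
    have hadg0 : 0 < p.adg := hpadg ▸ mul_pos hαdg hε
    have haΦ0 : 0 < p.aPhi := hpaΦ ▸ mul_pos hαΦ hε
    have hKG : Mg + Lg * (ε / LΦ) / p.adg ≤ K := by
      have e : Lg * (ε / LΦ) / p.adg = Lg / (LΦ * αdg) := by
        rw [hpadg]
        field_simp
      rw [e, hK]
      linarith
    have hUg := Storm.accum_gErr_le (x0 := x0) hreg hr hT0 hag0.le (hpag ▸ hag1.le) hBg0 hSg0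
    have hUdg := Storm.accum_dgErr_le (x0 := x0) hreg hr hT0 hadg0.le (hpadg ▸ hadg1.le)
      hBdg0 hSdg0
    have hUF := Storm.accum_FErr_le (x0 := x0) hreg hr hT0 hadg0 (hpadg ▸ hadg1.le) haΦ0.le
      (hpaΦ ▸ haΦ1.le) hBg0 hBdg0 hBf0 hSdg0 hSf0 hKG
    rw [hLΦ] at hpeta hLΦ0
    have hmain := Storm.mean_norm_gradient_output_le (x0 := x0) hreg hT0 hLΦ0 hpeta
      (hpeps ▸ hε) hbdd
    rw [← hLΦ] at hpeta hLΦ0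
    set Ug := Storm.accum P p x0 (Storm.gErr P)
    set UG := Storm.accum P p x0 (Storm.dgErr P)
    set UF := Storm.accum P p x0 (Storm.FErr P)
    rw [hpag, hSg, hBg, hT] at hUg
    rw [hpadg, hSdg, hBdg, hT] at hUdg
    rw [hpag, hpadg, hpaΦ, hSf, hBg, hBdg, hBf, hT] at hUF
    have hUg' := accum_bound_of_params hLΦ0 hτ0 hε hαg hβg hγg hUg
    have hUG' := accum_bound_of_params hLΦ0 hτ0 hε hαdg hβdg hγdg hUdg
    have hDg := drift_bound_of_params hLΦ0 hτ0 hε hαg hβg hγg hH30 hag1 hUg'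
    have hDG := drift_bound_of_params hLΦ0 hτ0 hε hαdg hβdg hγdg hH20 hadg1 hUG'
    have hUF' := accum_outer_bound_of_params hτ0 hε hαΦ hβf hγf hDG hDg hUF
    have hsum : 3 * UF + 3 * Mf ^ 2 * UG + 3 * Mg ^ 2 * Lf ^ 2 * Ug ≤ τ * (1 / 16) := by
      have h1 := mul_le_mul_of_nonneg_left hUG' (by positivity : 0 ≤ 3 * Mf ^ 2)
      have h2 := mul_le_mul_of_nonneg_left hUg' (by positivity : 0 ≤ 3 * Mg ^ 2 * Lf ^ 2)
      have h3 := mul_le_mul_of_nonneg_left hcond hτ0.le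
      -- What the accuracy condition leaves over: half of the direct contributions of the initial
      -- errors of `G` and `g`, namely of `6 Mf² H2 / (τ αdg γdg)` and `6 Lf² Mg² H3 / (τ αg γg)`.
      have h4 : 0 ≤ 3 * Mf ^ 2 * H2 / (αdg * γdg) + 3 * Mg ^ 2 * Lf ^ 2 * H3 / (αg * γg) := by
        positivity
      refine le_trans ?_ h3
      refine (add_le_add (add_le_add (mul_le_mul_of_nonneg_left hUF' zero_le_three) h1)
        h2).trans ?_
      rw [← sub_nonneg]
      refine h4.trans_eq ?_
      clear_value τ
      field_simp
      ring
    rw [← hLΦ, ← hΔ, hpeps, hT] at hmain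
    have e1 : τ * (ε ^ 2)⁻¹ * (ε ^ 2 / 2) = τ / 2 := by field_simp
    have e2 : τ * (ε ^ 2)⁻¹ * ε = τ / ε := by field_simp
    have e3 : 2 * LΦ * Δ = 3 / 16 * τ := by
      rw [hτ]
      ring
    rw [e1, e2, e3] at hmain
    refine le_of_mul_le_mul_left (hmain.trans ?_) (div_pos hτ0 hε)
    rw [div_mul_cancel₀ _ hε.ne']
    linarith
  · intro ω
    rw [Storm.ifo, Storm.length_log_state ω le_rfl]
    push_cast
    rw [hBg, hBdg, hBf, hSg, hSdg, hSf, hT]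
    field_simp
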